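/- Let $n\ge 0$ be an integer, $q=e^{2\pi\sqrt{-1}\,\tau}$ with $\operatorname{Im}\tau>0$, and write $q^a=e^{2\pi\sqrt{-1}\,\tau a}$ for $a\in\mathbb C$. Put $(x)_\infty=\prod_{\nu\ge 0}(1-q^\nu x)$ and $(x;c)_r=\prod_{\nu=0}^{r-1}(1-c^\nu x)$. Let $\gamma,\beta_1,\beta_2\in\mathbb C$ and $x_1,x_2\in\mathbb C^*$ be such that $q^{k\gamma}\ne 1$ for $1\le k\le n$ and $\frac{x_2}{x_1}q^{-\beta_2-k\gamma}\neq 1$ for $0\le k<n$. For $0\le s\le n$ let $$\psi_s(t)=\sum_{\sigma\in\mathfrak S_n}\operatorname{sgn}\sigma\cdot\sigma\Big[\prod_{k=1}^n\frac1{1-t_k/x_1}\prod_{k=1}^{n-s}\frac{1-q^{\beta_1}t_k/x_1}{1-t_k/x_2}\prod_{1\le i<j\le n}(t_i-q^{-\gamma}t_j)\Big],$$ where $\sigma$ permutes the variables $t_1,\dots,t_n$, and let $\varphi_s(t)$ be obtained from $\psi_s(t)$ by exchanging $(x_1,\beta_1)$ and $(x_2,\beta_2)$. (1) There is a unique $(n+1)\times(n+1)$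 matrix $R_{2,1}(\frac{x_2}{x_1})$ of constants with $(\varphi_0,\varphi_1,\dots,\varphi_n)\,R_{2,1}(\frac{x_2}{x_1})=(\psi_n,\psi_{n-1},\dots,\psi_0)$ as rational functions of $t$, and $$\det R_{2,1}\big(\tfrac{x_2}{x_1}\big)=\prod_{r=0}^n q^{-(n-r)(\beta_2+r\gamma)}\,\frac{(\frac{x_2}{x_1}q^{\beta_1};q^\gamma)_r}{(\frac{x_2}{x_1}q^{-\beta_2-(r-1)\gamma};q^\gamma)_r}.$$ (2) For $\tilde\alpha\in\mathbb C$ put $\alpha_j=\tilde\alpha-n+j-2(j-1)\gamma$ and $$\Phi(t)=\prod_{j=1}^n t_j^{\alpha_j}\prod_{j=1}^n\frac{(t_j/x_1)_\infty (t_j/x_2)_\infty}{(q^{\beta_1}t_j/x_1)_\infty(q^{\beta_2}t_j/x_2)_\infty}\prod_{1\le i<j\le n}\frac{(q^{1-\gamma}t_j/t_i)_\infty}{(q^\gamma t_j/t_i)_\infty},$$ and let $\widetilde\varphi_s(\xi)=(1-q)^n\sum_{\nu\in\mathbb Z^n}(\Phi\varphi_s)(q^{\nu_1}\xi_1,\dots,q^{\nu_n}\xi_n)$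 be the Jackson integral over the lattice $\langle\xi\rangle$, $\xi\in(\mathbb C^*)^n$. Here $t_j^{\alpha_j}=q^{\alpha_jX_j}$ after a choice of $X$ with $\xi_j=q^{X_j}$, continued to the lattice by $X_j\mapsto X_j+\nu_j$, and the singularities of $\Phi\varphi_s$ at $t_j=x_1,x_2$, which are removable, are removed. Let $T_2$ be the shift $x_2\mapsto qx_2$. Consider matrices $K=K(x_1,x_2)$ that represent the $q$-difference system $$T_2(\widetilde\varphi_0,\dots,\widetilde\varphi_n)=(\widetilde\varphi_0,\dots,\widetilde\varphi_n)\,K(x_1,x_2),$$ i.e. for which this holds for all $\xi$ (and all choices of $X$) such that $\langle\xi\rangle$ avoids the poles of $\Phi$ and the Jackson integrals of all terms of the alternating sums converge absolutely, both at $(x_1,x_2)$ and at $(x_1,qx_2)$. For every $\tilde\alpha$ there is such a $K(x_1,x_2)$ with $$\det K(x_1,x_2)=q^{(\tilde\alpha-(n-1)\gamma)\,n(n+1)/2}\,\det R_{2,1}\big(\tfrac{x_2}{x_1}\big);$$ so this is the determinant of $K(x_1,x_2)$ whenever the system determines that matrix. (3) Suppose the parameters are generic: $q^{k\gamma+m}\ne1$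 for $1\le k\le n$, $m\in\mathbb Z$, and, for all integers $m$ and $|k|\le n$, none of $\frac{x_2}{x_1}q^{k\gamma+m}$, $q^{\beta_1+k\gamma+m}$, $q^{\beta_2+k\gamma+m}$, $\frac{x_2}{x_1}q^{\beta_1+k\gamma+m}$, $\frac{x_1}{x_2}q^{\beta_2+k\gamma+m}$ equals $1$. Then there is $\delta>0$ such that for every $\tilde\alpha$ with $|q^{\tilde\alpha}|<\delta$ the system determines $K(x_1,x_2)$ uniquely, and its determinant is given by the formula in (2). -/

import Mathlib

noncomputable section

namespace QKZ

/-- `q ^ a` for `q = exp (2 π √-1 τ)`; in particular `q = qPow τ 1`. -/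
def qPow (τ a : ℂ) : ℂ := Complex.exp (2 * Real.pi * Complex.I * τ * a)

/-- `(x; c)_∞ = ∏_{ν ≥ 0} (1 - c ^ ν x)`, used for `|c| < 1`. -/
def qPochInf (x c : ℂ) : ℂ := ∏' ν : ℕ, (1 - c ^ ν * x)

/-- `(x; c)_r = (1 - x) (1 - c x) ⋯ (1 - c ^ (r - 1) x)`. -/
def qPoch (x c : ℂ) (r : ℕ) : ℂ := ∏ ν ∈ Finset.range r, (1 - c ^ ν * x)

/-- `𝒜 g (t) = ∑_σ sgn σ · g (t_{σ 1}, …, t_{σ n})`. -/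
def altSum {n : ℕ} (g : (Fin n → ℂ) → ℂ) (t : Fin n → ℂ) : ℂ :=
  ∑ σ : Equiv.Perm (Fin n), ((Equiv.Perm.sign σ : ℤ) : ℂ) * g (t ∘ σ)

/-- `∏_{i < j} (t_i - q ^ (-γ) t_j)`. -/
def qVand {n : ℕ} (τ γ : ℂ) (t : Fin n → ℂ) : ℂ :=
  ∏ i : Fin n, ∏ j ∈ Finset.Ioi i, (t i - qPow τ (-γ) * t j)

/-- The function under the alternating sum in Matsuo's `ψ_{(n - l, l)}[y₁, y₂; b₁, b₂]` (which does
not involve `b₂`):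
`∏_{k ≤ n} 1 / (1 - t_k / y₁) · ∏_{k ≤ l} (1 - q ^ b₁ t_k / y₁) / (1 - t_k / y₂)
  · ∏_{i < j} (t_i - q ^ (-γ) t_j)`. -/
def matsuoTerm {n : ℕ} (τ γ y₁ y₂ b₁ : ℂ) (l : ℕ) (t : Fin n → ℂ) : ℂ :=
  (∏ k : Fin n, 1 / (1 - t k / y₁)) *
    (∏ k : Fin n with k.val < l, (1 - qPow τ b₁ * t k / y₁) / (1 - t k / y₂)) * qVand τ γ t

/-- Matsuo's rational function `ψ_{(s, n - s)}[y₁, y₂; b₁, b₂] (t)`. -/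
def matsuo {n : ℕ} (τ γ y₁ y₂ b₁ : ℂ) (s : ℕ) : (Fin n → ℂ) → ℂ :=
  altSum (matsuoTerm τ γ y₁ y₂ b₁ (n - s))

/-- `(φ_0, …, φ_n) R = (ψ_n, …, ψ_0)` as rational functions of `t`, where
`ψ_s = ψ_{(s, n - s)}[x₁, x₂; β₁, β₂]` and `φ_s = ψ_{(s, n - s)}[x₂, x₁; β₂, β₁]`. -/
def IsRMatrix (n : ℕ) (τ γ x₁ x₂ β₁ β₂ : ℂ) (R : Matrix (Fin (n + 1)) (Fin (n + 1)) ℂ) : Prop :=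
  ∀ t : Fin n → ℂ, (∀ k, t k ≠ x₁ ∧ t k ≠ x₂) → ∀ j : Fin (n + 1),
    ∑ i : Fin (n + 1), matsuo τ γ x₂ x₁ β₂ i.val t * R i j = matsuo τ γ x₁ x₂ β₁ (n - j.val) t

/-- The factors of `Φ` that do not involve `(t_j / x_1)_∞ (t_j / x_2)_∞`. The argument `X` is a
logarithmic coordinate: `t_j = q ^ X_j`, and `t_j ^ α_j` means `q ^ (α_j X_j)`, with
`α_j = α - n + j - 2 (j - 1) γ` for `j = 1, …, n`. -/
def PhiCore {n : ℕ} (τ α γ x₁ x₂ β₁ β₂ : ℂ) (X : Fin n → ℂ) : ℂ :=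
  (∏ j : Fin n, qPow τ ((α - n + (j.val + 1) - 2 * j.val * γ) * X j)) *
    (∏ j : Fin n, 1 / (qPochInf (qPow τ (X j) * qPow τ β₁ / x₁) (qPow τ 1) *
      qPochInf (qPow τ (X j) * qPow τ β₂ / x₂) (qPow τ 1))) *
    ∏ i : Fin n, ∏ j ∈ Finset.Ioi i,
      qPochInf (qPow τ (1 - γ) * qPow τ (X j) / qPow τ (X i)) (qPow τ 1) /
        qPochInf (qPow τ γ * qPow τ (X j) / qPow τ (X i)) (qPow τ 1)

/-- The function
`Φ (t) = ∏_j t_j ^ α_j · ∏_j (t_j / x₁)_∞ (t_j / x₂)_∞ / ((t_j q^β₁ / x₁)_∞ (t_j q^β₂ / x₂)_∞)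
  · ∏_{i < j} (q ^ (1 - γ) t_j / t_i)_∞ / (q ^ γ t_j / t_i)_∞`. -/
def Phi {n : ℕ} (τ α γ x₁ x₂ β₁ β₂ : ℂ) (X : Fin n → ℂ) : ℂ :=
  PhiCore τ α γ x₁ x₂ β₁ β₂ X *
    ∏ j : Fin n, (qPochInf (qPow τ (X j) / x₁) (qPow τ 1) *
      qPochInf (qPow τ (X j) / x₂) (qPow τ 1))

/-- `Φ (t) / ∏_j (1 - t_j / x₁) (1 - t_j / x₂)`, with its removable singularities at `t_j = x₁` and
`t_j = x₂` removed. -/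
def PhiReg {n : ℕ} (τ α γ x₁ x₂ β₁ β₂ : ℂ) (X : Fin n → ℂ) : ℂ :=
  PhiCore τ α γ x₁ x₂ β₁ β₂ X *
    ∏ j : Fin n, (qPochInf (qPow τ 1 * qPow τ (X j) / x₁) (qPow τ 1) *
      qPochInf (qPow τ 1 * qPow τ (X j) / x₂) (qPow τ 1))

/-- `∏_j (1 - t_j / y₁) (1 - t_j / y₂)` times the function under the alternating sum in Matsuo's
`ψ_{(n - l, l)}`, which is a polynomial in `t`. -/
def matsuoNumTerm {n : ℕ} (τ γ y₁ y₂ b₁ : ℂ) (l : ℕ) (t : Fin n → ℂ) : ℂ :=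
  (∏ k : Fin n, if k.val < l then 1 - qPow τ b₁ * t k / y₁ else 1 - t k / y₂) * qVand τ γ t

/-- `∏_j (1 - t_j / y₁) (1 - t_j / y₂) · ψ_{(s, n - s)}[y₁, y₂; b₁, b₂] (t)`. -/
def matsuoNum {n : ℕ} (τ γ y₁ y₂ b₁ : ℂ) (s : ℕ) : (Fin n → ℂ) → ℂ :=
  altSum (matsuoNumTerm τ γ y₁ y₂ b₁ (n - s))

lemma matsuoNumTerm_eq {n : ℕ} (τ γ y₁ y₂ b₁ : ℂ) (l : ℕ) (t : Fin n → ℂ)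
    (h₁ : ∀ k, 1 - t k / y₁ ≠ 0) (h₂ : ∀ k, 1 - t k / y₂ ≠ 0) :
    matsuoNumTerm τ γ y₁ y₂ b₁ l t =
      (∏ k, ((1 - t k / y₁) * (1 - t k / y₂))) * matsuoTerm τ γ y₁ y₂ b₁ l t := by
  unfold matsuoNumTerm matsuoTerm
  rw [Finset.prod_filter, ← mul_assoc, ← Finset.prod_mul_distrib, ← Finset.prod_mul_distrib]
  congr 1
  refine Finset.prod_congr rfl fun k _ => ?_
  have := h₁ k
  have := h₂ k
  split_ifs <;> field_simp

lemma matsuoNum_eq {n : ℕ} (τ γ y₁ y₂ b₁ : ℂ) (s : ℕ) (t : Fin n → ℂ)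
    (h₁ : ∀ k, 1 - t k / y₁ ≠ 0) (h₂ : ∀ k, 1 - t k / y₂ ≠ 0) :
    matsuoNum τ γ y₁ y₂ b₁ s t =
      (∏ k, ((1 - t k / y₁) * (1 - t k / y₂))) * matsuo τ γ y₁ y₂ b₁ s t := by
  unfold matsuoNum matsuo altSum
  rw [Finset.mul_sum]
  refine Finset.sum_congr rfl fun σ _ => ?_
  rw [matsuoNumTerm_eq τ γ y₁ y₂ b₁ (n - s) (t ∘ σ) (fun k => h₁ (σ k)) (fun k => h₂ (σ k))]
  have : ∏ k, ((1 - (t ∘ σ) k / y₁) * (1 - (t ∘ σ) k / y₂)) =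
      ∏ k, ((1 - t k / y₁) * (1 - t k / y₂)) :=
    Equiv.prod_comp σ (fun k => (1 - t k / y₁) * (1 - t k / y₂))
  rw [this]
  ring

lemma norm_qPow_one_lt {τ : ℂ} (hτ : 0 < τ.im) : ‖qPow τ 1‖ < 1 := by
  unfold qPow
  rw [Complex.norm_exp, Real.exp_lt_one_iff]
  have : (2 * Real.pi * Complex.I * τ * 1 : ℂ).re = -(2 * Real.pi * τ.im) := by
    simp
  rw [this]
  have := Real.pi_pos
  have : 0 < 2 * Real.pi * τ.im := by positivity
  linarith

lemma qPochInf_eq {c : ℂ} (hc : ‖c‖ < 1) (x : ℂ) :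
    qPochInf x c = (1 - x) * qPochInf (c * x) c := by
  unfold qPochInf
  have hm : ∀ y : ℂ, Multipliable fun ν : ℕ => 1 - c ^ ν * y := by
    intro y
    have : Multipliable fun ν : ℕ => 1 + -(c ^ ν * y) := by
      refine multipliable_one_add_of_summable ?_
      simp only [norm_neg, norm_mul, norm_pow]
      exact (summable_geometric_of_lt_one (norm_nonneg c) hc).mul_right _
    simpa [sub_eq_add_neg] using this
  have e : (fun ν : ℕ => 1 - c ^ (ν + 1) * x) = fun ν : ℕ => 1 - c ^ ν * (c * x) := by
    funext ν
    ring
  have hm' : Multipliable fun ν : ℕ => 1 - c ^ (ν + 1) * x := by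
    rw [e]
    exact hm (c * x)
  have h := tprod_eq_zero_mul' (f := fun ν : ℕ => 1 - c ^ ν * x) hm'
  simp only [e, pow_zero, one_mul] at h
  exact h

/-- `(x; c)_r = (x; c)_∞ / (x c ^ r; c)_∞`. -/
lemma qPoch_eq {c : ℂ} (hc : ‖c‖ < 1) (x : ℂ) (r : ℕ) :
    qPochInf x c = qPoch x c r * qPochInf (x * c ^ r) c := by
  induction r with
  | zero => simp [qPoch]
  | succ r ih =>
    rw [ih, qPochInf_eq hc (x * c ^ r)]
    unfold qPoch
    rw [Finset.prod_range_succ]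
    have : c * (x * c ^ r) = x * c ^ (r + 1) := by ring
    rw [this]
    ring

/-- Away from `t_j = x₁, x₂` the regularised product is literally `Φ φ_s`. -/
lemma PhiReg_mul_matsuoNum {n : ℕ} (τ α γ x₁ x₂ β₁ β₂ : ℂ) (hτ : 0 < τ.im) (s : ℕ)
    (X : Fin n → ℂ) (h₁ : ∀ k, 1 - qPow τ (X k) / x₁ ≠ 0) (h₂ : ∀ k, 1 - qPow τ (X k) / x₂ ≠ 0) :
    PhiReg τ α γ x₁ x₂ β₁ β₂ X * matsuoNum τ γ x₂ x₁ β₂ s (fun j => qPow τ (X j)) =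
      Phi τ α γ x₁ x₂ β₁ β₂ X * matsuo τ γ x₂ x₁ β₂ s (fun j => qPow τ (X j)) := by
  rw [matsuoNum_eq _ _ _ _ _ _ _ h₂ h₁]
  unfold PhiReg Phi
  have key : (∏ j : Fin n, (qPochInf (qPow τ (X j) / x₁) (qPow τ 1) *
      qPochInf (qPow τ (X j) / x₂) (qPow τ 1))) =
      (∏ j : Fin n, (qPochInf (qPow τ 1 * qPow τ (X j) / x₁) (qPow τ 1) *
        qPochInf (qPow τ 1 * qPow τ (X j) / x₂) (qPow τ 1))) *
      ∏ k, ((1 - qPow τ (X k) / x₂) * (1 - qPow τ (X k) / x₁)) := by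
    rw [← Finset.prod_mul_distrib]
    refine Finset.prod_congr rfl fun j _ => ?_
    rw [qPochInf_eq (norm_qPow_one_lt hτ) (qPow τ (X j) / x₁),
      qPochInf_eq (norm_qPow_one_lt hτ) (qPow τ (X j) / x₂), mul_div_assoc, mul_div_assoc]
    ring
  rw [key]
  ring

/-- Jackson integral over the lattice `⟨ξ⟩`, `ξ_j = q ^ X_j`:
`(1 - q) ^ n ∑_{ν ∈ ℤⁿ} f (q ^ ν₁ ξ₁, …, q ^ ν_n ξ_n)`, for `f` in logarithmic coordinates. -/
def jackson {n : ℕ} (τ : ℂ) (f : (Fin n → ℂ) → ℂ) (X : Fin n → ℂ) : ℂ :=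
  (1 - qPow τ 1) ^ n * ∑' ν : Fin n → ℤ, f (fun j => X j + ν j)

/-- `φ̃_s (ξ) = ∫_⟨ξ⟩ Φ φ_s ϖ`, where `ξ_j = q ^ X_j`. -/
def phiTilde {n : ℕ} (τ α γ x₁ x₂ β₁ β₂ : ℂ) (s : ℕ) (X : Fin n → ℂ) : ℂ :=
  jackson τ (fun Y => PhiReg τ α γ x₁ x₂ β₁ β₂ Y *
    matsuoNum τ γ x₂ x₁ β₂ s (fun j => qPow τ (Y j))) X

/-- The lattice `⟨ξ⟩`, `ξ_j = q ^ X_j`, does not meet the poles of `Φ`. -/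
def AvoidsPoles {n : ℕ} (τ γ x₁ x₂ β₁ β₂ : ℂ) (X : Fin n → ℂ) : Prop :=
  (∀ (j : Fin n) (m : ℤ), qPow τ (X j + β₁ + m) ≠ x₁ ∧ qPow τ (X j + β₂ + m) ≠ x₂) ∧
  ∀ (i j : Fin n) (m : ℤ), i < j → qPow τ (X j + γ + m) ≠ qPow τ (X i)

/-- The Jackson integrals over `⟨ξ⟩`, `ξ_j = q ^ X_j`, of all the terms of the alternating sums
`Φ φ_0, …, Φ φ_n` converge absolutely. -/
def Converges {n : ℕ} (τ α γ x₁ x₂ β₁ β₂ : ℂ) (X : Fin n → ℂ) : Prop :=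
  ∀ (s : Fin (n + 1)) (σ : Equiv.Perm (Fin n)), Summable fun ν : Fin n → ℤ =>
    PhiReg τ α γ x₁ x₂ β₁ β₂ (fun j => X j + ν j) *
      matsuoNumTerm τ γ x₂ x₁ β₂ (n - s.val) ((fun j => qPow τ (X j + ν j)) ∘ σ)

/-- `K` represents the `q`-difference system
`T₂ (φ̃_0, …, φ̃_n) = (φ̃_0, …, φ̃_n) K`, where `T₂` is the shift `x₂ ↦ q x₂`: the equation holds on
every lattice which avoids the poles and on which the Jackson integrals on both sides converge. -/
def RepresentsSystem (n : ℕ) (τ α γ x₁ x₂ β₁ β₂ : ℂ)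
    (K : Matrix (Fin (n + 1)) (Fin (n + 1)) ℂ) : Prop :=
  ∀ X : Fin n → ℂ, AvoidsPoles τ γ x₁ x₂ β₁ β₂ X →
    Converges τ α γ x₁ x₂ β₁ β₂ X → Converges τ α γ x₁ (qPow τ 1 * x₂) β₁ β₂ X →
    ∀ s : Fin (n + 1), phiTilde τ α γ x₁ (qPow τ 1 * x₂) β₁ β₂ s.val X =
      ∑ r : Fin (n + 1), phiTilde τ α γ x₁ x₂ β₁ β₂ r.val X * K r s

/-- Genericity of the parameters: there are no multiplicative resonances. -/
def Generic (n : ℕ) (τ γ x₁ x₂ β₁ β₂ : ℂ) : Prop :=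
  (∀ (k : ℕ) (m : ℤ), 1 ≤ k → k ≤ n → qPow τ (k * γ + m) ≠ 1) ∧
  ∀ k m : ℤ, |k| ≤ (n : ℤ) →
    x₂ * qPow τ (k * γ + m) ≠ x₁ ∧
    qPow τ (β₁ + k * γ + m) ≠ 1 ∧ qPow τ (β₂ + k * γ + m) ≠ 1 ∧
    x₂ * qPow τ (β₁ + k * γ + m) ≠ x₁ ∧ x₁ * qPow τ (β₂ + k * γ + m) ≠ x₂

end QKZ

end

noncomputable section

open Finset Polynomial

namespace QKZ

/-! Write `Q = q ^ (-γ)`. The function `(t_{i+1} - Q t_i) ∏_{a < b} (t_a - Q t_b)` is symmetric in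
`t_i, t_{i+1}`, so its antisymmetrization vanishes, also after multiplication by any monomial in the
other variables. Hence the alternating sum of `∏_{k ∈ S} t_k · ∏_{a < b} (t_a - Q t_b)` depends, up
to a power of `Q`, on `|S|` only. The alternating sum of a product of affine functions is therefore
a linear functional of one polynomial in `z`, the specialization `t_k = Q ^ k z` of that product
(`altSum_prod_affine`). Conversely, at `t_k = Q ^ k z` only the identity permutation contributes to
the alternating sum, so the polynomial can be recovered (`altSum_mul_qVand_principal`). The relation
defining `R` thus becomes `A R = B` for two coefficient matrices of explicit polynomials, whose
determinants follow from column differences (`det_stepMatrix`, `det_stepMatrixRev`).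

For the system, take the term of `Φ φ_s` at `q x₂` attached to `σ` and shift by `q` the variables in
its last `s` positions. By `(x)_∞ = (1 - x) (q x)_∞` the result is `q ^ ((α - (n - 1) γ) s)` times a
term of `Φ ψ_{n-s}` at `x₂`, attached to `σ` times a block rotation (`term_shift`). A Jackson sum is
invariant under such shifts, so `K` may be taken as `R` times a diagonal matrix (`phiTilde_shift`,
`exists_representsSystem`).

For uniqueness, the system is tested on `n + 1` lattices, the `r`-th through the point `(x₁, q ^ γ
x₁, …; x₂, q ^ γ x₂, …)` with `r` entries in the first chain. There `Φ` is supported on `ν ≥ 0`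
(`nonneg_of_PhiReg_ne_zero`), so up to an invertible factor each integral is a power series in `w =
q ^ α`. The matrix of constant terms is triangular with nonzero diagonal after reversing its columns
(`det_chainCoeff_zero_ne_zero`); the matrix of integrals is then invertible for small `w`, and `K`
is determined. -/

/-! ### Powers of `q`. -/

lemma qPow_add (τ a b : ℂ) : qPow τ (a + b) = qPow τ a * qPow τ b := by
  unfold qPow
  rw [← Complex.exp_add]
  ring_nf

lemma qPow_ne_zero (τ a : ℂ) : qPow τ a ≠ 0 := Complex.exp_ne_zero _

@[simp] lemma qPow_zero (τ : ℂ) : qPow τ 0 = 1 := by simp [qPow]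

lemma qPow_neg (τ a : ℂ) : qPow τ (-a) = (qPow τ a)⁻¹ := by
  unfold qPow
  rw [← Complex.exp_neg]
  ring_nf

lemma qPow_sub (τ a b : ℂ) : qPow τ (a - b) = qPow τ a / qPow τ b := by
  rw [sub_eq_add_neg, qPow_add, qPow_neg, div_eq_mul_inv]

lemma qPow_nat_mul (τ a : ℂ) (k : ℕ) : qPow τ (k * a) = qPow τ a ^ k := by
  unfold qPow
  rw [← Complex.exp_nat_mul]
  ring_nf

lemma qPow_int_mul (τ a : ℂ) (k : ℤ) : qPow τ (k * a) = qPow τ a ^ k := by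
  unfold qPow
  rw [← Complex.exp_int_mul]
  ring_nf

lemma qPow_sum {ι : Type*} (τ : ℂ) (s : Finset ι) (f : ι → ℂ) :
    qPow τ (∑ i ∈ s, f i) = ∏ i ∈ s, qPow τ (f i) := by
  unfold qPow
  rw [← Complex.exp_sum, Finset.mul_sum]

/-! ### Alternating sums and the principal specialization. -/

lemma altSum_comp_perm {n : ℕ} (g : (Fin n → ℂ) → ℂ) (π : Equiv.Perm (Fin n)) (t : Fin n → ℂ) :
    altSum (fun t => g (t ∘ π)) t = ((Equiv.Perm.sign π : ℤ) : ℂ) * altSum g t := by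
  unfold altSum
  rw [Finset.mul_sum, ← Equiv.sum_comp (Equiv.mulRight π)
    (fun σ => ((Equiv.Perm.sign π : ℤ) : ℂ) * (((Equiv.Perm.sign σ : ℤ) : ℂ) * g (t ∘ σ)))]
  refine Finset.sum_congr rfl fun σ _ => ?_
  have h : ((Equiv.Perm.sign π : ℤ) : ℂ) * ((Equiv.Perm.sign π : ℤ) : ℂ) = 1 := by
    rw [← Int.cast_mul, ← Units.val_mul, Int.units_mul_self]
    simp
  simp only [Equiv.coe_mulRight, Equiv.Perm.sign_mul, Units.val_mul, Int.cast_mul,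
    Equiv.Perm.coe_mul, Function.comp_assoc]
  linear_combination (-((Equiv.Perm.sign σ : ℤ) : ℂ) * g (t ∘ σ ∘ π)) * h

lemma altSum_eq_zero_of_comp_swap {n : ℕ} (g : (Fin n → ℂ) → ℂ) {i j : Fin n} (hij : i ≠ j)
    (hg : ∀ t, g (t ∘ Equiv.swap i j) = g t) (t : Fin n → ℂ) : altSum g t = 0 := by
  have h := altSum_comp_perm g (Equiv.swap i j) t
  simp only [hg, Equiv.Perm.sign_swap hij] at h
  push_cast at h
  have : altSum g t = -1 * altSum g t := h
  linear_combination this / 2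

lemma qVand_eq_prod_pairs {n : ℕ} (τ γ : ℂ) (t : Fin n → ℂ) :
    qVand τ γ t = ∏ p : Fin n × Fin n with p.1 < p.2, (t p.1 - qPow τ (-γ) * t p.2) := by
  unfold qVand
  rw [Finset.prod_filter, ← Finset.univ_product_univ, Finset.prod_product]
  refine Finset.prod_congr rfl fun i _ => ?_
  rw [← Finset.prod_filter]
  refine Finset.prod_congr ?_ fun _ _ => rfl
  ext j
  simp

/-- An adjacent transposition inverts a single pair, so it permutes the remaining factors of
`qVand`. -/
lemma swap_castSucc_succ_lt_iff {m : ℕ} (i : Fin m) (a b : Fin (m + 1)) :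
    (Equiv.swap i.castSucc i.succ a < Equiv.swap i.castSucc i.succ b ∧
      ¬(Equiv.swap i.castSucc i.succ a = i.castSucc ∧ Equiv.swap i.castSucc i.succ b = i.succ)) ↔
    (a < b ∧ ¬(a = i.castSucc ∧ b = i.succ)) := by
  simp only [Equiv.swap_apply_def, Fin.ext_iff, Fin.lt_def]
  split_ifs <;> simp_all <;> omega

/-- Only the factor of the pair `(i, i + 1)` changes. The identity is cross-multiplied because that
factor may vanish. -/
lemma qVand_comp_swap {m : ℕ} (τ γ : ℂ) (i : Fin m) (t : Fin (m + 1) → ℂ) :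
    qVand τ γ (t ∘ Equiv.swap i.castSucc i.succ) * (t i.castSucc - qPow τ (-γ) * t i.succ) =
      qVand τ γ t * (t i.succ - qPow τ (-γ) * t i.castSucc) := by
  set s := Equiv.swap i.castSucc i.succ with hs
  have split : ∀ u : Fin (m + 1) → ℂ, qVand τ γ u =
      (u i.castSucc - qPow τ (-γ) * u i.succ) *
        ∏ p : Fin (m + 1) × Fin (m + 1) with p.1 < p.2 ∧ ¬(p.1 = i.castSucc ∧ p.2 = i.succ),
          (u p.1 - qPow τ (-γ) * u p.2) := by
    intro u
    rw [qVand_eq_prod_pairs, ← Finset.mul_prod_erase _ _ (a := (i.castSucc, i.succ)) (by simp)]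
    congr 1
    refine Finset.prod_congr ?_ fun _ _ => rfl
    ext p
    simp only [Finset.mem_erase, Finset.mem_filter, Finset.mem_univ, true_and, ne_eq, Prod.ext_iff]
    tauto
  rw [split t, split (t ∘ s)]
  have : ∏ p : Fin (m + 1) × Fin (m + 1) with p.1 < p.2 ∧ ¬(p.1 = i.castSucc ∧ p.2 = i.succ),
          ((t ∘ s) p.1 - qPow τ (-γ) * (t ∘ s) p.2) =
      ∏ p : Fin (m + 1) × Fin (m + 1) with p.1 < p.2 ∧ ¬(p.1 = i.castSucc ∧ p.2 = i.succ),
          (t p.1 - qPow τ (-γ) * t p.2) := by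
    refine Finset.prod_equiv (Equiv.prodCongr s s) ?_ ?_
    · intro p
      simp only [Finset.mem_filter, Finset.mem_univ, true_and, Equiv.prodCongr_apply, Prod.map]
      exact (swap_castSucc_succ_lt_iff i p.1 p.2).symm
    · intro p _
      simp
  rw [this]
  simp only [Function.comp_apply, hs, Equiv.swap_apply_left, Equiv.swap_apply_right]
  ring

/-- The alternating sum of `∏_{k ∈ S} t_k · ∏_{i < j} (t_i - q ^ (-γ) t_j)`. -/
def monoAlt {n : ℕ} (τ γ : ℂ) (S : Finset (Fin n)) (t : Fin n → ℂ) : ℂ :=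
  altSum (fun t => (∏ k ∈ S, t k) * qVand τ γ t) t

/-- By `qVand_comp_swap` the product of `t_{i+1} - Q t_i` with `qVand` is symmetric in the two
variables, and so is the monomial over `T`; the antisymmetrization of their product is zero, and it
is the difference of the two sides. -/
lemma monoAlt_insert_succ {m : ℕ} (τ γ : ℂ) (i : Fin m) (T : Finset (Fin (m + 1)))
    (h₀ : i.castSucc ∉ T) (h₁ : i.succ ∉ T) (t : Fin (m + 1) → ℂ) :
    monoAlt τ γ (insert i.succ T) t = qPow τ (-γ) * monoAlt τ γ (insert i.castSucc T) t := by
  have h := altSum_eq_zero_of_comp_swap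
    (fun t => (∏ k ∈ T, t k) * ((t i.succ - qPow τ (-γ) * t i.castSucc) * qVand τ γ t))
    (i := i.castSucc) (j := i.succ) (Fin.castSucc_lt_succ).ne ?_ t
  · rw [← sub_eq_zero, ← h]
    unfold monoAlt altSum
    rw [Finset.mul_sum, ← Finset.sum_sub_distrib]
    refine Finset.sum_congr rfl fun σ _ => ?_
    simp only [Finset.prod_insert h₀, Finset.prod_insert h₁]
    ring
  · intro t
    have hT : ∏ k ∈ T, (t ∘ Equiv.swap i.castSucc i.succ) k = ∏ k ∈ T, t k := by
      refine Finset.prod_congr rfl fun k hk => ?_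
      rw [Function.comp_apply, Equiv.swap_apply_of_ne_of_ne]
      · rintro rfl; exact h₀ hk
      · rintro rfl; exact h₁ hk
    simp only [hT]
    have := qVand_comp_swap τ γ i t
    simp only [Function.comp_apply, Equiv.swap_apply_left, Equiv.swap_apply_right]
    linear_combination (∏ k ∈ T, t k) * this

/-- `monoAlt`, normalised so that it depends on the cardinality of `S` only. -/
def normAlt {n : ℕ} (τ γ : ℂ) (S : Finset (Fin n)) (t : Fin n → ℂ) : ℂ :=
  (∏ k ∈ S, qPow τ (-γ) ^ k.val)⁻¹ * monoAlt τ γ S t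

lemma normAlt_insert_succ {m : ℕ} (τ γ : ℂ) (i : Fin m) (T : Finset (Fin (m + 1)))
    (h₀ : i.castSucc ∉ T) (h₁ : i.succ ∉ T) (t : Fin (m + 1) → ℂ) :
    normAlt τ γ (insert i.succ T) t = normAlt τ γ (insert i.castSucc T) t := by
  unfold normAlt
  rw [monoAlt_insert_succ τ γ i T h₀ h₁, Finset.prod_insert h₀, Finset.prod_insert h₁]
  have := qPow_ne_zero τ (-γ)
  simp only [Fin.val_succ, Fin.val_castSucc, pow_succ]
  field_simp

lemma normAlt_image_swap {m : ℕ} (τ γ : ℂ) (i : Fin m) (S : Finset (Fin (m + 1)))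
    (t : Fin (m + 1) → ℂ) :
    normAlt τ γ (S.image (Equiv.swap i.castSucc i.succ)) t = normAlt τ γ S t := by
  have hne : i.castSucc ≠ i.succ := (Fin.castSucc_lt_succ).ne
  have fixT : ∀ T : Finset (Fin (m + 1)), i.castSucc ∉ T → i.succ ∉ T →
      T.image (Equiv.swap i.castSucc i.succ) = T := by
    intro T h₀ h₁
    rw [Finset.image_congr (g := id) ?_, Finset.image_id]
    intro k hk
    refine Equiv.swap_apply_of_ne_of_ne ?_ ?_
    · rintro rfl; exact h₀ hk
    · rintro rfl; exact h₁ hk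
  set T := (S.erase i.castSucc).erase i.succ with hT
  have h₀ : i.castSucc ∉ T := by simp [hT]
  have h₁ : i.succ ∉ T := by simp [hT]
  by_cases a : i.castSucc ∈ S <;> by_cases b : i.succ ∈ S
  · have : S = insert i.castSucc (insert i.succ T) := by
      rw [hT, Finset.insert_erase (by simp [b, hne.symm]), Finset.insert_erase a]
    rw [this, Finset.image_insert, Finset.image_insert, fixT T h₀ h₁, Equiv.swap_apply_left,
      Equiv.swap_apply_right, Finset.insert_comm]
  · have : S = insert i.castSucc T := by
      rw [hT, Finset.erase_eq_of_notMem (a := i.succ) (by simp [b]), Finset.insert_erase a]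
    rw [this, Finset.image_insert, fixT T h₀ h₁, Equiv.swap_apply_left]
    exact normAlt_insert_succ τ γ i T h₀ h₁ t
  · have : S = insert i.succ T := by
      rw [hT, Finset.erase_eq_of_notMem a, Finset.insert_erase b]
    rw [this, Finset.image_insert, fixT T h₀ h₁, Equiv.swap_apply_right]
    exact (normAlt_insert_succ τ γ i T h₀ h₁ t).symm
  · rw [fixT S a b]

/-- Adjacent transpositions generate the symmetric group. -/
lemma normAlt_image {n : ℕ} (τ γ : ℂ) (π : Equiv.Perm (Fin n)) (S : Finset (Fin n))
    (t : Fin n → ℂ) : normAlt τ γ (S.image π) t = normAlt τ γ S t := by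
  cases n with
  | zero => rw [Subsingleton.elim (S.image π) S]
  | succ m =>
    have hπ : π ∈ Submonoid.closure
        (Set.range fun i : Fin m => Equiv.swap i.castSucc i.succ) := by
      rw [Equiv.Perm.mclosure_swap_castSucc_succ]
      trivial
    induction hπ using Submonoid.closure_induction generalizing S with
    | mem x hx =>
      obtain ⟨i, rfl⟩ := hx
      exact normAlt_image_swap τ γ i S t
    | one => simp
    | mul x y _ _ hx hy =>
      rw [Equiv.Perm.coe_mul, ← Finset.image_image, hx, hy]

lemma normAlt_eq_of_card {n : ℕ} (τ γ : ℂ) {S S' : Finset (Fin n)} (h : S.card = S'.card)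
    (t : Fin n → ℂ) : normAlt τ γ S t = normAlt τ γ S' t := by
  let e : {x // x ∈ S} ≃ {x // x ∈ S'} := Finset.equivOfCardEq h
  have : S.image e.extendSubtype = S' := by
    refine Finset.eq_of_subset_of_card_le ?_ ?_
    · intro y hy
      obtain ⟨x, hx, rfl⟩ := Finset.mem_image.mp hy
      exact e.extendSubtype_mem x hx
    · rw [Finset.card_image_of_injective _ e.extendSubtype.injective, h]
  rw [← this, normAlt_image]

/-- The linear functional on polynomials through which the alternating sums of products of affine
functions factor. -/
def altFunctional {n : ℕ} (τ γ : ℂ) (t : Fin n → ℂ) : ℂ[X] →ₗ[ℂ] ℂ :=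
  Polynomial.lsum fun l => normAlt τ γ {k : Fin n | k.val < l} t • LinearMap.id

lemma altFunctional_C_mul_X_pow {n : ℕ} (τ γ : ℂ) (t : Fin n → ℂ) (S : Finset (Fin n)) (c : ℂ) :
    altFunctional τ γ t (C c * X ^ S.card) = c * normAlt τ γ S t := by
  have hc : ({k : Fin n | k.val < S.card} : Finset (Fin n)).card = S.card := by
    rw [Fin.card_filter_val_lt, min_eq_right]
    simpa using Finset.card_le_univ S
  unfold altFunctional
  rw [Polynomial.C_mul_X_pow_eq_monomial, Polynomial.lsum_apply, Polynomial.sum_monomial_index]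
  · simp [normAlt_eq_of_card τ γ hc, mul_comm]
  · simp

/-- The polynomial in `z` obtained from `∏_k (a_k + b_k t_k)` by putting `t_k = q ^ (-k γ) z`. -/
def principalPoly {n : ℕ} (τ γ : ℂ) (a b : Fin n → ℂ) : ℂ[X] :=
  ∏ k : Fin n, (C (a k) + C (b k * qPow τ (-γ) ^ k.val) * X)

/-- Both sides expand over subsets `S`. Putting `t_k = Q ^ k z` turns `∏_{k ∈ S} t_k` into `z ^ |S|`
times exactly the power of `Q` by which `normAlt` is normalized. -/
lemma altSum_prod_affine {n : ℕ} (τ γ : ℂ) (a b : Fin n → ℂ) (t : Fin n → ℂ) :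
    altSum (fun t => (∏ k, (a k + b k * t k)) * qVand τ γ t) t =
      altFunctional τ γ t (principalPoly τ γ a b) := by
  have h₁ : altSum (fun t => (∏ k, (a k + b k * t k)) * qVand τ γ t) t =
      ∑ S : Finset (Fin n), ((∏ k ∈ S, b k) * ∏ k ∈ univ \ S, a k) * monoAlt τ γ S t := by
    simp only [monoAlt, altSum, Finset.mul_sum]
    rw [Finset.sum_comm]
    refine Finset.sum_congr rfl fun σ _ => ?_
    have : ∏ k, (a k + b k * (t ∘ σ) k) = ∑ S : Finset (Fin n),
        (∏ k ∈ S, b k * (t ∘ σ) k) * ∏ k ∈ univ \ S, a k := by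
      rw [← Finset.powerset_univ, ← Finset.prod_add]
      exact Finset.prod_congr rfl fun _ _ => add_comm _ _
    rw [this, Finset.sum_mul, Finset.mul_sum]
    refine Finset.sum_congr rfl fun S _ => ?_
    rw [Finset.prod_mul_distrib]
    ring
  have h₂ : principalPoly τ γ a b = ∑ S : Finset (Fin n),
      C (((∏ k ∈ S, b k) * ∏ k ∈ univ \ S, a k) * ∏ k ∈ S, qPow τ (-γ) ^ k.val) *
        X ^ S.card := by
    have : principalPoly τ γ a b = ∑ S : Finset (Fin n),
        (∏ k ∈ S, (C (b k * qPow τ (-γ) ^ k.val) * X)) * ∏ k ∈ univ \ S, C (a k) := by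
      rw [← Finset.powerset_univ, ← Finset.prod_add]
      exact Finset.prod_congr rfl fun _ _ => add_comm _ _
    rw [this]
    refine Finset.sum_congr rfl fun S _ => ?_
    rw [Finset.prod_mul_distrib, Finset.prod_const, ← map_prod, ← map_prod,
      Finset.prod_mul_distrib]
    simp only [map_mul]
    ring
  rw [h₁, h₂, map_sum]
  refine Finset.sum_congr rfl fun S _ => ?_
  rw [altFunctional_C_mul_X_pow, normAlt]
  have : ∏ k ∈ S, qPow τ (-γ) ^ k.val ≠ 0 :=
    Finset.prod_ne_zero_iff.mpr fun k _ => pow_ne_zero _ (qPow_ne_zero _ _)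
  field_simp

/-- The hypothesis says that `v + 1` never occurs before `v`, so the inverse of `σ` is increasing,
and an increasing bijection of a finite chain is the identity. -/
lemma perm_eq_one_of_forall_ne {n : ℕ} (σ : Equiv.Perm (Fin n))
    (h : ∀ a b : Fin n, a < b → (σ a).val ≠ (σ b).val + 1) : σ = 1 := by
  cases n with
  | zero => exact Subsingleton.elim _ _
  | succ m =>
    have hm : StrictMono σ.symm := by
      rw [Fin.strictMono_iff_lt_succ]
      intro i
      rcases lt_trichotomy (σ.symm i.castSucc) (σ.symm i.succ) with h' | h' | h'
      · exact h'
      · exact absurd (σ.symm.injective h') (Fin.castSucc_lt_succ).ne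
      · have := h _ _ h'
        simp at this
    have : ⇑σ.symm = id := by
      have h2 := Subsingleton.elim (hm.orderIsoOfSurjective _ σ.symm.surjective)
        (OrderIso.refl (Fin (m + 1)))
      funext x
      exact congrArg (fun f : Fin (m + 1) ≃o Fin (m + 1) => f x) h2
    ext x
    have hx := congrFun this (σ x)
    simp at hx
    simp [← hx]

/-- Every `σ ≠ 1` has positions `a < b` with `σ a = σ b + 1`, and the factor of `qVand` at this pair
is zero on a geometric progression of ratio `Q`. -/
lemma altSum_mul_qVand_principal {n : ℕ} (τ γ : ℂ) (g : (Fin n → ℂ) → ℂ) (z : ℂ) :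
    altSum (fun t => g t * qVand τ γ t) (fun k => z * qPow τ (-γ) ^ k.val) =
      g (fun k => z * qPow τ (-γ) ^ k.val) *
        qVand τ γ (fun k : Fin n => z * qPow τ (-γ) ^ k.val) := by
  unfold altSum
  rw [Finset.sum_eq_single 1]
  · simp
  · intro σ _ hσ
    have : ∃ a b : Fin n, a < b ∧ (σ a).val = (σ b).val + 1 := by
      by_contra! h
      exact hσ (perm_eq_one_of_forall_ne σ h)
    obtain ⟨a, b, hab, e⟩ := this
    have : qVand τ γ ((fun k => z * qPow τ (-γ) ^ k.val) ∘ σ) = 0 := by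
      unfold qVand
      refine Finset.prod_eq_zero (Finset.mem_univ a)
        (Finset.prod_eq_zero (Finset.mem_Ioi.mpr hab) ?_)
      simp only [Function.comp_apply, e, pow_succ]
      ring
    change _ * (g _ * qVand τ γ _) = 0
    rw [this]
    simp
  · simp

lemma qVand_principal_ne_zero {n : ℕ} (τ γ : ℂ)
    (hγ : ∀ k : ℕ, 1 ≤ k → k ≤ n → qPow τ (k * γ) ≠ 1) {z : ℂ} (hz : z ≠ 0) :
    qVand τ γ (fun k : Fin n => z * qPow τ (-γ) ^ k.val) ≠ 0 := by
  unfold qVand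
  refine Finset.prod_ne_zero_iff.mpr fun i _ => Finset.prod_ne_zero_iff.mpr fun j hj => ?_
  have hij : i < j := Finset.mem_Ioi.mp hj
  have hlt : i.val < j.val := hij
  -- The factor at `(i, j)` is `z Q ^ i (1 - Q ^ d)` with `d = j - i + 1`, which lies between `2`
  -- and `n`.
  obtain ⟨d, hd⟩ : ∃ d, j.val + 1 = i.val + d := ⟨j.val + 1 - i.val, by omega⟩
  have hq := qPow_ne_zero τ (-γ)
  intro h
  refine hγ d (by omega) (by have := j.isLt; omega) ?_
  have e : qPow τ (-γ) ^ (j.val + 1) = qPow τ (-γ) ^ i.val := by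
    have : z * (qPow τ (-γ) ^ (j.val + 1) - qPow τ (-γ) ^ i.val) = 0 := by
      rw [pow_succ]
      linear_combination -h
    exact sub_eq_zero.mp ((mul_eq_zero.mp this).resolve_left hz)
  rw [hd, pow_add] at e
  have e' : qPow τ (-γ) ^ d = 1 :=
    mul_left_cancel₀ (pow_ne_zero i.val hq) (by rw [e, mul_one])
  rw [qPow_nat_mul]
  rw [qPow_neg, inv_pow, inv_eq_one] at e'
  exact e'

lemma eval_principalPoly {n : ℕ} (τ γ : ℂ) (a b : Fin n → ℂ) (z : ℂ) :
    (principalPoly τ γ a b).eval z =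
      ∏ k : Fin n, (a k + b k * (z * qPow τ (-γ) ^ k.val)) := by
  unfold principalPoly
  rw [Polynomial.eval_prod]
  refine Finset.prod_congr rfl fun k _ => ?_
  simp
  ring

/-! ### Step polynomials and the determinants of their coefficients. -/

/-- `∏_{k < l} (1 - a Q ^ k z) · ∏_{l ≤ k < l + m} (1 - b Q ^ k z)`. -/
def stepPoly (Q a b : ℂ) (l m : ℕ) : ℂ[X] :=
  (∏ k ∈ range l, (1 - C (a * Q ^ k) * X)) * ∏ k ∈ range m, (1 - C (b * Q ^ (l + k)) * X)

/-- The two products differ in the factor number `l` only. The common cofactor is again a step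
polynomial, with one factor fewer and `b` replaced by `b Q`, which is what makes the determinant
recursive. -/
lemma stepPoly_succ_left (Q a b : ℂ) (l m : ℕ) :
    stepPoly Q a b (l + 1) m =
      stepPoly Q a b l (m + 1) + C ((b - a) * Q ^ l) * X * stepPoly Q a (b * Q) l m := by
  have h : ∏ k ∈ range m, (1 - C (b * Q ^ (l + 1 + k)) * X) =
      ∏ k ∈ range m, (1 - C (b * Q * Q ^ (l + k)) * X) :=
    Finset.prod_congr rfl fun k _ => by ring_nf
  have h' : ∏ k ∈ range m, (1 - C (b * Q ^ (l + (k + 1))) * X) =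
      ∏ k ∈ range m, (1 - C (b * Q * Q ^ (l + k)) * X) :=
    Finset.prod_congr rfl fun k _ => by ring_nf
  unfold stepPoly
  rw [Finset.prod_range_succ, Finset.prod_range_succ', h, h', add_zero]
  simp only [map_mul, map_sub]
  ring

lemma coeff_zero_stepPoly (Q a b : ℂ) (l m : ℕ) : (stepPoly Q a b l m).coeff 0 = 1 := by
  rw [Polynomial.coeff_zero_eq_eval_zero]
  simp [stepPoly, Polynomial.eval_prod]

/-- The reduction of the determinant of coefficients of polynomials whose successive
differences are divisible by `z`. -/
lemma det_coeff_of_succ_eq {n : ℕ} (p : Fin (n + 2) → ℂ[X]) (r : Fin (n + 1) → ℂ[X])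
    (d : Fin (n + 1) → ℂ) (h₀ : (p 0).coeff 0 = 1)
    (hp : ∀ j : Fin (n + 1), p j.succ = p j.castSucc + C (d j) * X * r j) :
    (Matrix.of fun i j : Fin (n + 2) => (p j).coeff i.val).det =
      (∏ j, d j) * (Matrix.of fun i j : Fin (n + 1) => (r j).coeff i.val).det := by
  -- Each column is replaced by its difference with the preceding one; the top row becomes `(1, 0,
  -- …, 0)`, and the cofactor has the coefficients of `d j * r j`.
  rw [Matrix.det_eq_of_forall_col_eq_smul_add_pred (fun _ => 1)
    (B := Matrix.of fun i j : Fin (n + 2) =>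
      (Fin.cases (p 0) (fun j => C (d j) * X * r j) j : ℂ[X]).coeff i.val)
    (fun i => by simp) (fun i j => by simp [hp, add_comm])]
  rw [Matrix.det_succ_row_zero, Fin.sum_univ_succ]
  have hz : ∀ j : Fin (n + 1), (C (d j) * X * r j).coeff 0 = 0 := fun j => by
    simp [mul_assoc]
  simp only [Matrix.of_apply, Fin.cases_zero, Fin.cases_succ, Fin.val_zero, h₀, hz, pow_zero,
    one_mul, mul_zero, zero_mul, Finset.sum_const_zero, add_zero]
  rw [← Matrix.det_mul_row]
  congr 1
  ext i j
  simp [Matrix.submatrix, mul_assoc]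

/-- A power of `Q`, the determinant of the coefficients of `stepPoly` up to differences. -/
def stepConst (Q : ℂ) (n : ℕ) : ℂ := ∏ m ∈ range n, ∏ j ∈ range (m + 1), Q ^ j

lemma stepConst_ne_zero {Q : ℂ} (hQ : Q ≠ 0) (n : ℕ) : stepConst Q n ≠ 0 :=
  Finset.prod_ne_zero_iff.mpr fun _ _ => Finset.prod_ne_zero_iff.mpr fun _ _ => pow_ne_zero _ hQ

/-- The coefficients of `stepPoly Q a b j (n - j)`. -/
def stepMatrix (Q a b : ℂ) (n : ℕ) : Matrix (Fin (n + 1)) (Fin (n + 1)) ℂ :=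
  Matrix.of fun i j => (stepPoly Q a b j.val (n - j.val)).coeff i.val

/-- The coefficients of `stepPoly Q a b (n - j) j`. -/
def stepMatrixRev (Q a b : ℂ) (n : ℕ) : Matrix (Fin (n + 1)) (Fin (n + 1)) ℂ :=
  Matrix.of fun i j => (stepPoly Q a b (n - j.val) j.val).coeff i.val

lemma prod_pow_succ_sub (f : ℕ → ℂ) (n : ℕ) :
    ∏ m ∈ range (n + 1), f m ^ (n + 1 - m) =
      f 0 ^ (n + 1) * ∏ m ∈ range n, f (m + 1) ^ (n - m) := by
  rw [Finset.prod_range_succ', mul_comm]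
  simp

/-- Induction on `n`: taking column differences extracts `∏_j (b - a) Q ^ j` and leaves the matrix
of size one less for the pair `(a, b Q)`. -/
lemma det_stepMatrix (Q : ℂ) (n : ℕ) (a b : ℂ) :
    (stepMatrix Q a b n).det =
      stepConst Q n * ∏ m ∈ range n, (b * Q ^ m - a) ^ (n - m) := by
  induction n generalizing b with
  | zero => simp [stepMatrix, stepConst, coeff_zero_stepPoly]
  | succ n ih =>
    have key := det_coeff_of_succ_eq
      (fun j : Fin (n + 2) => stepPoly Q a b j.val (n + 1 - j.val))
      (fun j : Fin (n + 1) => stepPoly Q a (b * Q) j.val (n - j.val))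
      (fun j => (b - a) * Q ^ j.val) (coeff_zero_stepPoly _ _ _ _ _) (fun j => by
        have h₁ : n + 1 - (j.val + 1) = n - j.val := by omega
        have h₂ : n + 1 - j.val = n - j.val + 1 := by omega
        simp only [Fin.val_succ, Fin.val_castSucc, h₁, h₂]
        exact stepPoly_succ_left _ _ _ _ _)
    have ih' := ih (b * Q)
    unfold stepMatrix at ih' ⊢
    rw [key, ih', prod_pow_succ_sub (fun m => b * Q ^ m - a), Finset.prod_mul_distrib,
      Fin.prod_univ_eq_prod_range (fun j => Q ^ j)]
    simp only [stepConst, Finset.prod_range_succ _ n, Finset.prod_const, Finset.card_univ,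
      Fintype.card_fin, pow_zero, mul_one, pow_succ' Q, ← mul_assoc]
    ring

lemma det_stepMatrixRev (Q : ℂ) (n : ℕ) (a b : ℂ) :
    (stepMatrixRev Q a b n).det =
      stepConst Q n * ∏ m ∈ range n, (a - b * Q ^ m) ^ (n - m) := by
  induction n generalizing b with
  | zero => simp [stepMatrixRev, stepConst, coeff_zero_stepPoly]
  | succ n ih =>
    have key := det_coeff_of_succ_eq
      (fun j : Fin (n + 2) => stepPoly Q a b (n + 1 - j.val) j.val)
      (fun j : Fin (n + 1) => stepPoly Q a (b * Q) (n - j.val) j.val)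
      (fun j => (a - b) * Q ^ (n - j.val)) (coeff_zero_stepPoly _ _ _ _ _) (fun j => by
        have h₁ : n + 1 - (j.val + 1) = n - j.val := by omega
        have h₂ : n + 1 - j.val = n - j.val + 1 := by omega
        simp only [Fin.val_succ, Fin.val_castSucc, h₁, h₂, stepPoly_succ_left]
        simp only [map_mul, map_sub]
        ring)
    have ih' := ih (b * Q)
    unfold stepMatrixRev at ih' ⊢
    have hr : ∏ j : Fin (n + 1), Q ^ (n - j.val) = ∏ j ∈ range (n + 1), Q ^ j := by
      rw [Fin.prod_univ_eq_prod_range (fun j => Q ^ (n - j)), ← Finset.prod_range_reflect]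
      refine Finset.prod_congr rfl fun j hj => ?_
      have := Finset.mem_range.mp hj
      congr 1
      omega
    rw [key, ih', prod_pow_succ_sub (fun m => a - b * Q ^ m), Finset.prod_mul_distrib, hr]
    simp only [stepConst, Finset.prod_range_succ _ n, Finset.prod_const, Finset.card_univ,
      Fintype.card_fin, pow_zero, mul_one, pow_succ' Q, ← mul_assoc]
    ring

/-- The factor `f m` occurs once for each `r` with `m < r ≤ n`. -/
lemma prod_prod_range (f : ℕ → ℂ) (n : ℕ) :
    ∏ r ∈ range (n + 1), ∏ m ∈ range r, f m = ∏ m ∈ range n, f m ^ (n - m) := by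
  induction n with
  | zero => simp
  | succ n ih =>
    rw [Finset.prod_range_succ, ih, Finset.prod_range_succ _ n, Finset.prod_range_succ _ n,
      ← mul_assoc, ← Finset.prod_mul_distrib]
    congr 1
    · refine Finset.prod_congr rfl fun m hm => ?_
      rw [← pow_succ]
      congr 1
      have := Finset.mem_range.mp hm
      omega
    · simp

/-! ### Matsuo's functions through step polynomials, and the matrix `R`. -/

lemma stepPoly_eq_principalPoly {n : ℕ} (τ γ a b : ℂ) {l : ℕ} (hl : l ≤ n) :
    stepPoly (qPow τ (-γ)) a b l (n - l) =
      principalPoly τ γ (fun _ : Fin n => 1) (fun k => -(if k.val < l then a else b)) := by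
  unfold principalPoly stepPoly
  rw [Fin.prod_univ_eq_prod_range
    (fun k => C 1 + C (-(if k < l then a else b) * qPow τ (-γ) ^ k) * X)]
  conv_rhs => rw [show n = l + (n - l) by omega, Finset.prod_range_add]
  congr 1
  · refine Finset.prod_congr rfl fun k hk => ?_
    rw [if_pos (Finset.mem_range.mp hk)]
    simp [sub_eq_add_neg]
  · refine Finset.prod_congr rfl fun k hk => ?_
    rw [if_neg (by omega)]
    simp [sub_eq_add_neg]

lemma matsuoNumTerm_eq_affine {n : ℕ} (τ γ y₁ y₂ b₁ : ℂ) (l : ℕ) :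
    (matsuoNumTerm τ γ y₁ y₂ b₁ l : (Fin n → ℂ) → ℂ) = fun t =>
      (∏ k, (1 + -(if k.val < l then qPow τ b₁ / y₁ else 1 / y₂) * t k)) * qVand τ γ t := by
  funext t
  unfold matsuoNumTerm
  congr 1
  refine Finset.prod_congr rfl fun k _ => ?_
  split_ifs <;> ring

lemma matsuoNum_eq_altFunctional {n : ℕ} (τ γ y₁ y₂ b₁ : ℂ) (s : ℕ) (t : Fin n → ℂ) :
    matsuoNum τ γ y₁ y₂ b₁ s t = altFunctional τ γ t
      (stepPoly (qPow τ (-γ)) (qPow τ b₁ / y₁) (1 / y₂) (n - s) (n - (n - s))) := by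
  rw [stepPoly_eq_principalPoly τ γ _ _ (Nat.sub_le n s), ← altSum_prod_affine]
  unfold matsuoNum
  rw [matsuoNumTerm_eq_affine]

lemma matsuoNum_principal {n : ℕ} (τ γ y₁ y₂ b₁ : ℂ) (s : ℕ) (z : ℂ) :
    matsuoNum τ γ y₁ y₂ b₁ s (fun k : Fin n => z * qPow τ (-γ) ^ k.val) =
      (stepPoly (qPow τ (-γ)) (qPow τ b₁ / y₁) (1 / y₂) (n - s) (n - (n - s))).eval z *
        qVand τ γ (fun k : Fin n => z * qPow τ (-γ) ^ k.val) := by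
  rw [stepPoly_eq_principalPoly τ γ _ _ (Nat.sub_le n s), eval_principalPoly]
  unfold matsuoNum
  rw [matsuoNumTerm_eq_affine]
  exact altSum_mul_qVand_principal τ γ _ z

lemma natDegree_stepPoly_le (Q a b : ℂ) (l m : ℕ) : (stepPoly Q a b l m).natDegree ≤ l + m := by
  unfold stepPoly
  refine Polynomial.natDegree_mul_le.trans (Nat.add_le_add ?_ ?_)
  all_goals
    refine (Polynomial.natDegree_prod_le _ _).trans ?_
    refine (Finset.sum_le_card_nsmul _ _ 1 fun k _ => ?_).trans (by simp)
    compute_degree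

/-- The product formula for the determinant of `R_{2,1} (x₂ / x₁)`. -/
def detR (n : ℕ) (τ γ x₁ x₂ β₁ β₂ : ℂ) : ℂ :=
  ∏ r ∈ range (n + 1), qPow τ (-((n - r) * (β₂ + r * γ))) *
    (qPoch (x₂ / x₁ * qPow τ β₁) (qPow τ γ) r /
      qPoch (x₂ / x₁ * qPow τ (-β₂ - (r - 1) * γ)) (qPow τ γ) r)

section RMatrix

variable {n : ℕ} {τ γ x₁ x₂ β₁ β₂ : ℂ}

lemma det_stepMatrixRev_ne_zero (hx₁ : x₁ ≠ 0) (hx₂ : x₂ ≠ 0)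
    (hden : ∀ k : ℕ, k < n → x₂ / x₁ * qPow τ (-β₂ - k * γ) ≠ 1) :
    (stepMatrixRev (qPow τ (-γ)) (qPow τ β₂ / x₂) (1 / x₁) n).det ≠ 0 := by
  rw [det_stepMatrixRev]
  refine mul_ne_zero (stepConst_ne_zero (qPow_ne_zero _ _) n)
    (Finset.prod_ne_zero_iff.mpr fun m hm => pow_ne_zero _ fun h => ?_)
  refine hden m (Finset.mem_range.mp hm) ?_
  rw [qPow_sub, qPow_neg, qPow_nat_mul]
  rw [qPow_neg, inv_pow] at h
  have h₁ := qPow_ne_zero τ β₂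
  have h₂ := qPow_ne_zero τ γ
  field_simp at h ⊢
  linear_combination -h

/-- The constants `stepConst` agree, so the claim reduces to the `n - m`-th power of one identity
for each `m < n`, namely that of `Q ^ m / x₂ - q ^ β₁ / x₁` with `q ^ β₂ / x₂ - Q ^ m / x₁`. -/
lemma detR_mul_det_stepMatrixRev (hx₁ : x₁ ≠ 0) (hx₂ : x₂ ≠ 0)
    (hden : ∀ k : ℕ, k < n → x₂ / x₁ * qPow τ (-β₂ - k * γ) ≠ 1) :
    detR n τ γ x₁ x₂ β₁ β₂ * (stepMatrixRev (qPow τ (-γ)) (qPow τ β₂ / x₂) (1 / x₁) n).det =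
      (stepMatrix (qPow τ (-γ)) (qPow τ β₁ / x₁) (1 / x₂) n).det := by
  have hβ := qPow_ne_zero τ β₂
  have hc := qPow_ne_zero τ γ
  have e₁ : ∏ r ∈ range (n + 1), qPow τ (-((n - r) * (β₂ + r * γ))) =
      ∏ m ∈ range n, (qPow τ β₂ * qPow τ γ ^ m)⁻¹ ^ (n - m) := by
    rw [Finset.prod_range_succ, sub_self, zero_mul, neg_zero, qPow_zero, mul_one]
    refine Finset.prod_congr rfl fun m hm => ?_
    have hm' := (Finset.mem_range.mp hm).le
    rw [← qPow_nat_mul, ← qPow_add, ← qPow_neg, ← qPow_nat_mul]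
    congr 1
    push_cast [hm']
    ring
  -- Reading the product backwards removes the dependence of its base point on `r`, as
  -- `prod_prod_range` requires.
  have e₂ : ∀ r : ℕ, qPoch (x₂ / x₁ * qPow τ (-β₂ - (r - 1) * γ)) (qPow τ γ) r =
      ∏ m ∈ range r, (1 - x₂ / x₁ * qPow τ (-β₂ - m * γ)) := by
    intro r
    unfold qPoch
    rw [← Finset.prod_range_reflect]
    refine Finset.prod_congr rfl fun m hm => ?_
    have hm' := Finset.mem_range.mp hm
    rw [← qPow_nat_mul, mul_left_comm, ← qPow_add, Nat.sub_sub]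
    congr 3
    push_cast [show 1 + m ≤ r by omega]
    ring
  unfold detR
  simp only [e₂]
  rw [Finset.prod_mul_distrib, Finset.prod_div_distrib, e₁]
  unfold qPoch
  rw [prod_prod_range, prod_prod_range, det_stepMatrix, det_stepMatrixRev]
  rw [mul_left_comm, ← Finset.prod_div_distrib, ← Finset.prod_mul_distrib,
    ← Finset.prod_mul_distrib]
  congr 1
  refine Finset.prod_congr rfl fun m hm => ?_
  rw [← div_pow, ← mul_pow, ← mul_pow]
  congr 1
  have h := hden m (Finset.mem_range.mp hm)
  rw [qPow_sub, qPow_neg, qPow_nat_mul] at h ⊢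
  rw [qPow_neg, inv_pow]
  have h' : 1 - x₂ / x₁ * ((qPow τ β₂)⁻¹ / qPow τ γ ^ m) ≠ 0 := sub_ne_zero.mpr h.symm
  have e : qPow τ β₂ / x₂ - 1 / x₁ * (qPow τ γ ^ m)⁻¹ =
      qPow τ β₂ / x₂ * (1 - x₂ / x₁ * ((qPow τ β₂)⁻¹ / qPow τ γ ^ m)) := by
    field_simp
  rw [e]
  generalize 1 - x₂ / x₁ * ((qPow τ β₂)⁻¹ / qPow τ γ ^ m) = d at h'
  field_simp

/-- The matrix equation is an identity of polynomials, coefficient by coefficient up to degree `n`,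
beyond which both sides vanish. Applying `altFunctional` gives the identity of alternating sums,
with no genericity assumption on `γ`. -/
lemma matsuoNum_eq_sum_of_mul_eq {R : Matrix (Fin (n + 1)) (Fin (n + 1)) ℂ}
    (hR : stepMatrixRev (qPow τ (-γ)) (qPow τ β₂ / x₂) (1 / x₁) n * R =
      stepMatrix (qPow τ (-γ)) (qPow τ β₁ / x₁) (1 / x₂) n) (t : Fin n → ℂ) (j : Fin (n + 1)) :
    ∑ i : Fin (n + 1), matsuoNum τ γ x₂ x₁ β₂ i.val t * R i j =
      matsuoNum τ γ x₁ x₂ β₁ (n - j.val) t := by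
  have hj : n - (n - j.val) = j.val := by have := j.isLt; omega
  have hp : ∑ i : Fin (n + 1), C (R i j) *
      stepPoly (qPow τ (-γ)) (qPow τ β₂ / x₂) (1 / x₁) (n - i.val) i.val =
      stepPoly (qPow τ (-γ)) (qPow τ β₁ / x₁) (1 / x₂) j.val (n - j.val) := by
    ext l
    by_cases hl : l < n + 1
    · have := congrFun (congrFun hR ⟨l, hl⟩) j
      simp only [Matrix.mul_apply, stepMatrixRev, stepMatrix, Matrix.of_apply] at this
      simp only [Polynomial.finsetSum_coeff, Polynomial.coeff_C_mul]
      rw [← this]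
      exact Finset.sum_congr rfl fun i _ => mul_comm _ _
    · have hlt : ∀ a b c d, c + d = n → (stepPoly (qPow τ (-γ)) a b c d).coeff l = 0 :=
        fun a b c d h => Polynomial.coeff_eq_zero_of_natDegree_lt
          ((natDegree_stepPoly_le _ a b c d).trans_lt (by omega))
      rw [hlt _ _ _ _ (by have := j.isLt; omega)]
      simp only [Polynomial.finsetSum_coeff, Polynomial.coeff_C_mul]
      refine Finset.sum_eq_zero fun i _ => ?_
      rw [hlt _ _ _ _ (by have := i.isLt; omega), mul_zero]
  rw [matsuoNum_eq_altFunctional, hj, ← hp, map_sum]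
  refine Finset.sum_congr rfl fun i _ => ?_
  have hi : n - (n - i.val) = i.val := by have := i.isLt; omega
  rw [matsuoNum_eq_altFunctional, hi, ← Polynomial.smul_eq_C_mul, map_smul, smul_eq_mul, mul_comm]

lemma one_sub_div_ne_zero {x y : ℂ} (hy : y ≠ 0) (h : x ≠ y) : 1 - x / y ≠ 0 := by
  rw [sub_ne_zero]
  intro e
  exact h ((div_eq_one_iff_eq hy).mp e.symm)

lemma isRMatrix_of_mul_eq (hx₁ : x₁ ≠ 0) (hx₂ : x₂ ≠ 0)
    {R : Matrix (Fin (n + 1)) (Fin (n + 1)) ℂ}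
    (hR : stepMatrixRev (qPow τ (-γ)) (qPow τ β₂ / x₂) (1 / x₁) n * R =
      stepMatrix (qPow τ (-γ)) (qPow τ β₁ / x₁) (1 / x₂) n) :
    IsRMatrix n τ γ x₁ x₂ β₁ β₂ R := by
  intro t ht j
  have h₁ : ∀ k, 1 - t k / x₁ ≠ 0 := fun k => one_sub_div_ne_zero hx₁ (ht k).1
  have h₂ : ∀ k, 1 - t k / x₂ ≠ 0 := fun k => one_sub_div_ne_zero hx₂ (ht k).2
  have hP : ∏ k, ((1 - t k / x₁) * (1 - t k / x₂)) ≠ 0 :=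
    Finset.prod_ne_zero_iff.mpr fun k _ => mul_ne_zero (h₁ k) (h₂ k)
  refine mul_left_cancel₀ hP ?_
  rw [← matsuoNum_eq τ γ x₁ x₂ β₁ _ t h₁ h₂, ← matsuoNum_eq_sum_of_mul_eq hR, Finset.mul_sum]
  refine Finset.sum_congr rfl fun i _ => ?_
  rw [matsuoNum_eq τ γ x₂ x₁ β₂ _ t h₂ h₁, ← mul_assoc]
  congr 2
  exact Finset.prod_congr rfl fun k _ => mul_comm _ _

/-- At `t_k = Q ^ k z` the relation becomes, after cancelling the nonzero `qVand`, an equality of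
polynomial values at all but finitely many `z`. Here the condition on `q ^ (k γ)` enters. -/
lemma mul_eq_of_isRMatrix (hx₁ : x₁ ≠ 0) (hx₂ : x₂ ≠ 0)
    (hγ : ∀ k : ℕ, 1 ≤ k → k ≤ n → qPow τ (k * γ) ≠ 1)
    {R : Matrix (Fin (n + 1)) (Fin (n + 1)) ℂ} (hR : IsRMatrix n τ γ x₁ x₂ β₁ β₂ R) :
    stepMatrixRev (qPow τ (-γ)) (qPow τ β₂ / x₂) (1 / x₁) n * R =
      stepMatrix (qPow τ (-γ)) (qPow τ β₁ / x₁) (1 / x₂) n := by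
  set Q := qPow τ (-γ) with hQ
  have hQ0 : Q ≠ 0 := qPow_ne_zero _ _
  have hp : ∀ j : Fin (n + 1), ∑ i : Fin (n + 1), C (R i j) *
      stepPoly Q (qPow τ β₂ / x₂) (1 / x₁) (n - i.val) i.val =
      stepPoly Q (qPow τ β₁ / x₁) (1 / x₂) j.val (n - j.val) := by
    intro j
    rw [← sub_eq_zero]
    refine Polynomial.eq_zero_of_infinite_isRoot _ ?_
    -- The excluded `z`: the origin, where `qVand` may vanish, and the points that put a coordinate
    -- at `x₁` or `x₂`.
    let F : Set ℂ := insert 0 ((Set.range fun k : Fin n => x₁ / Q ^ k.val) ∪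
      Set.range fun k : Fin n => x₂ / Q ^ k.val)
    have hF : F.Finite := ((Set.finite_range _).union (Set.finite_range _)).insert 0
    refine hF.infinite_compl.mono fun z hz => ?_
    have hz0 : z ≠ 0 := fun h => hz (by simp [F, h])
    have hz1 : ∀ k : Fin n, z * Q ^ k.val ≠ x₁ ∧ z * Q ^ k.val ≠ x₂ := by
      intro k
      have hk : Q ^ k.val ≠ 0 := pow_ne_zero _ hQ0
      refine ⟨fun h => hz ?_, fun h => hz ?_⟩
      · exact Or.inr (Or.inl ⟨k, by simp only [← h]; field_simp⟩)
      · exact Or.inr (Or.inr ⟨k, by simp only [← h]; field_simp⟩)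
    have h₁ : ∀ k : Fin n, 1 - z * Q ^ k.val / x₁ ≠ 0 :=
      fun k => one_sub_div_ne_zero hx₁ (hz1 k).1
    have h₂ : ∀ k : Fin n, 1 - z * Q ^ k.val / x₂ ≠ 0 :=
      fun k => one_sub_div_ne_zero hx₂ (hz1 k).2
    have h := congrArg
      (fun y => (∏ k : Fin n, ((1 - z * Q ^ k.val / x₁) * (1 - z * Q ^ k.val / x₂))) * y)
      (hR (fun k => z * Q ^ k.val) hz1 j)
    beta_reduce at h
    have hj : n - (n - j.val) = j.val := by have := j.isLt; omega
    rw [← matsuoNum_eq τ γ x₁ x₂ β₁ _ _ h₁ h₂, hQ, matsuoNum_principal, hj, Finset.mul_sum] at h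
    have hV := qVand_principal_ne_zero (n := n) τ γ hγ hz0
    change Polynomial.eval z (_ - _) = 0
    rw [Polynomial.eval_sub, sub_eq_zero]
    refine mul_right_cancel₀ hV ?_
    rw [← h, Polynomial.eval_finsetSum, Finset.sum_mul]
    refine Finset.sum_congr rfl fun i _ => ?_
    have hi : n - (n - i.val) = i.val := by have := i.isLt; omega
    have h3 := matsuoNum_eq τ γ x₂ x₁ β₂ i.val (fun k : Fin n => z * Q ^ k.val) h₂ h₁
    rw [hQ, matsuoNum_principal, hi] at h3
    rw [← mul_assoc, Finset.prod_congr rfl fun k _ => mul_comm (1 - z * qPow τ (-γ) ^ k.val / x₁) _,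
      ← h3]
    simp only [Polynomial.eval_mul, Polynomial.eval_C, hQ]
    ring
  ext i j
  have := congrArg (fun p => p.coeff i.val) (hp j)
  simp only [Polynomial.finsetSum_coeff, Polynomial.coeff_C_mul] at this
  simp only [Matrix.mul_apply, stepMatrixRev, stepMatrix, Matrix.of_apply, ← this]
  exact Finset.sum_congr rfl fun i _ => mul_comm _ _

lemma existsUnique_isRMatrix (hx₁ : x₁ ≠ 0) (hx₂ : x₂ ≠ 0)
    (hγ : ∀ k : ℕ, 1 ≤ k → k ≤ n → qPow τ (k * γ) ≠ 1)
    (hden : ∀ k : ℕ, k < n → x₂ / x₁ * qPow τ (-β₂ - k * γ) ≠ 1) :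
    ∃! R, IsRMatrix n τ γ x₁ x₂ β₁ β₂ R := by
  have hu : IsUnit (stepMatrixRev (qPow τ (-γ)) (qPow τ β₂ / x₂) (1 / x₁) n).det :=
    (det_stepMatrixRev_ne_zero hx₁ hx₂ hden).isUnit
  refine ⟨(stepMatrixRev (qPow τ (-γ)) (qPow τ β₂ / x₂) (1 / x₁) n)⁻¹ *
    stepMatrix (qPow τ (-γ)) (qPow τ β₁ / x₁) (1 / x₂) n, ?_, fun R hR => ?_⟩
  · exact isRMatrix_of_mul_eq hx₁ hx₂ (Matrix.mul_nonsing_inv_cancel_left _ _ hu)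
  · rw [← mul_eq_of_isRMatrix hx₁ hx₂ hγ hR, Matrix.nonsing_inv_mul_cancel_left _ _ hu]

lemma det_of_isRMatrix (hx₁ : x₁ ≠ 0) (hx₂ : x₂ ≠ 0)
    (hγ : ∀ k : ℕ, 1 ≤ k → k ≤ n → qPow τ (k * γ) ≠ 1)
    (hden : ∀ k : ℕ, k < n → x₂ / x₁ * qPow τ (-β₂ - k * γ) ≠ 1)
    {R : Matrix (Fin (n + 1)) (Fin (n + 1)) ℂ} (hR : IsRMatrix n τ γ x₁ x₂ β₁ β₂ R) :
    R.det = detR n τ γ x₁ x₂ β₁ β₂ := by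
  have h := congrArg Matrix.det (mul_eq_of_isRMatrix hx₁ hx₂ hγ hR)
  rw [Matrix.det_mul, ← detR_mul_det_stepMatrixRev hx₁ hx₂ hden, mul_comm] at h
  exact mul_right_cancel₀ (det_stepMatrixRev_ne_zero hx₁ hx₂ hden) h

end RMatrix

/-! ### Shifting a block of variables in one term of the alternating sum. -/

/-- `sgn σ · ∏_{i < j} (t_{σ i} - q ^ (-γ) t_{σ j})` as a product over unpermuted pairs. -/
lemma sign_mul_qVand_comp {n : ℕ} (τ γ : ℂ) (σ : Equiv.Perm (Fin n)) (t : Fin n → ℂ) :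
    ((Equiv.Perm.sign σ : ℤ) : ℂ) * qVand τ γ (t ∘ σ) =
      ∏ i : Fin n, ∏ j ∈ Ioi i, (if σ.symm i < σ.symm j then t i - qPow τ (-γ) * t j
        else -(t j - qPow τ (-γ) * t i)) := by
  -- The factor is extended to an antisymmetric function of all pairs; the value `0` on the diagonal
  -- is forced by antisymmetry.
  let f : Fin n → Fin n → ℂ := fun i j => if σ.symm i < σ.symm j then t i - qPow τ (-γ) * t j
    else if σ.symm j < σ.symm i then -(t j - qPow τ (-γ) * t i) else 0
  have hf : ∀ i j, f i j = -f j i := by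
    intro i j
    rcases lt_trichotomy (σ.symm i) (σ.symm j) with h | h | h
    · simp [f, h, h.not_gt]
    · simp [f, h]
    · simp [f, h, h.not_gt]
  have key := Equiv.Perm.prod_Ioi_comp_eq_sign_mul_prod σ hf
  have e₁ : ∏ i : Fin n, ∏ j ∈ Ioi i, f (σ i) (σ j) = qVand τ γ (t ∘ σ) := by
    unfold qVand
    refine Finset.prod_congr rfl fun i _ => Finset.prod_congr rfl fun j hj => ?_
    have : i < j := Finset.mem_Ioi.mp hj
    simp [f, this]
  have e₂ : ∏ i : Fin n, ∏ j ∈ Ioi i, f i j = ∏ i : Fin n, ∏ j ∈ Ioi i,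
      (if σ.symm i < σ.symm j then t i - qPow τ (-γ) * t j
        else -(t j - qPow τ (-γ) * t i)) := by
    refine Finset.prod_congr rfl fun i _ => Finset.prod_congr rfl fun j hj => ?_
    have : i < j := Finset.mem_Ioi.mp hj
    rcases lt_trichotomy (σ.symm i) (σ.symm j) with h | h | h
    · simp [f, h]
    · exact absurd (σ.symm.injective h) this.ne
    · simp [f, h, h.not_gt]
  rw [e₁, e₂] at key
  rw [key, ← mul_assoc, ← Int.cast_mul, ← Units.val_mul, Int.units_mul_self]
  simp

section Quotients

variable {q : ℂ}

/-- The pair factor with `c = q ^ γ` when only `v` is shifted: the two factors split off by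
`qPochInf_eq` turn `u - c⁻¹ v` into `-(v - c⁻¹ u)`, that is, they exchange the order of the two
variables in `qVand`. -/
lemma pair_shift_right (hq : ‖q‖ < 1) {c u v : ℂ} (hc : c ≠ 0) (hu : u ≠ 0)
    (h : 1 - c * v / u ≠ 0) :
    qPochInf (q / c * (v * q) / u) q / qPochInf (c * (v * q) / u) q * (u - c⁻¹ * (v * q)) =
      c * (qPochInf (q / c * v / u) q / qPochInf (c * v / u) q * -(v - c⁻¹ * u)) := by
  have e₁ := qPochInf_eq hq (q / c * v / u)
  have e₂ := qPochInf_eq hq (c * v / u)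
  rw [show q * (q / c * v / u) = q / c * (v * q) / u by ring] at e₁
  rw [show q * (c * v / u) = c * (v * q) / u by ring] at e₂
  rw [e₁, e₂]
  have e₃ : u - c⁻¹ * (v * q) = u * (1 - q / c * v / u) := by field_simp
  have e₄ : -(v - c⁻¹ * u) = c⁻¹ * u * (1 - c * v / u) := by field_simp; ring
  rw [e₃, e₄]
  generalize 1 - c * v / u = d at h
  generalize 1 - q / c * v / u = d'
  rw [mul_div_mul_comm]
  field_simp

lemma pair_shift_left (hq : ‖q‖ < 1) (hq0 : q ≠ 0) {c u v : ℂ} (hc : c ≠ 0) (hu : u ≠ 0)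
    (h : 1 - c * v / (u * q) ≠ 0) :
    qPochInf (q / c * v / (u * q)) q / qPochInf (c * v / (u * q)) q * -(v - c⁻¹ * (u * q)) =
      q / c * (qPochInf (q / c * v / u) q / qPochInf (c * v / u) q * (u - c⁻¹ * v)) := by
  have e₁ := qPochInf_eq hq (q / c * v / (u * q))
  have e₂ := qPochInf_eq hq (c * v / (u * q))
  rw [show q * (q / c * v / (u * q)) = q / c * v / u by field_simp] at e₁
  rw [show q * (c * v / (u * q)) = c * v / u by field_simp] at e₂
  rw [e₁, e₂]
  have e₃ : -(v - c⁻¹ * (u * q)) = q / c * u * (1 - c * v / (u * q)) := by field_simp; ring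
  have e₄ : u - c⁻¹ * v = u * (1 - q / c * v / (u * q)) := by field_simp
  rw [e₃, e₄]
  generalize 1 - c * v / (u * q) = d at h
  generalize 1 - q / c * v / (u * q) = d'
  rw [mul_div_mul_comm]
  field_simp

lemma pair_shift_both (hq0 : q ≠ 0) (a u v : ℂ) : a * (v * q) / (u * q) = a * v / u := by
  rw [← mul_assoc, mul_div_mul_right _ _ hq0]

lemma single_unshifted (hq : ‖q‖ < 1) (hq0 : q ≠ 0) {x₁ x₂ b₁ b₂ t : ℂ}
    (h : 1 - b₂ * t / (q * x₂) ≠ 0) :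
    1 / (qPochInf (t * b₁ / x₁) q * qPochInf (t * b₂ / (q * x₂)) q) *
        (qPochInf (q * t / x₁) q * qPochInf (q * t / (q * x₂)) q) * (1 - b₂ * t / (q * x₂)) =
      1 / (qPochInf (t * b₁ / x₁) q * qPochInf (t * b₂ / x₂) q) *
        (qPochInf (q * t / x₁) q * qPochInf (q * t / x₂) q) * (1 - t / x₂) := by
  have e₁ := qPochInf_eq hq (t * b₂ / (q * x₂))
  have e₂ := qPochInf_eq hq (t / x₂)
  rw [show q * (t * b₂ / (q * x₂)) = t * b₂ / x₂ by field_simp, mul_comm t b₂] at e₁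
  rw [← mul_div_assoc] at e₂
  rw [mul_comm t b₂, e₁, mul_div_mul_left _ _ hq0, e₂]
  generalize 1 - b₂ * t / (q * x₂) = d at h
  field_simp

/-- Since `t / x₂` is unchanged when both `t` and `x₂` are multiplied by `q`, only the factors with
`x₁` contribute. -/
lemma single_shifted (hq : ‖q‖ < 1) (hq0 : q ≠ 0) {x₁ x₂ b₁ b₂ t : ℂ}
    (h : 1 - b₁ * t / x₁ ≠ 0) :
    1 / (qPochInf (t * q * b₁ / x₁) q * qPochInf (t * q * b₂ / (q * x₂)) q) *
        (qPochInf (q * (t * q) / x₁) q * qPochInf (q * (t * q) / (q * x₂)) q) * (1 - t * q / x₁) =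
      1 / (qPochInf (t * b₁ / x₁) q * qPochInf (t * b₂ / x₂) q) *
        (qPochInf (q * t / x₁) q * qPochInf (q * t / x₂) q) * (1 - b₁ * t / x₁) := by
  have e₁ := qPochInf_eq hq (b₁ * t / x₁)
  have e₂ := qPochInf_eq hq (q * t / x₁)
  rw [show q * (b₁ * t / x₁) = t * q * b₁ / x₁ by ring] at e₁
  rw [show q * (q * t / x₁) = q * (t * q) / x₁ by ring, mul_comm q t] at e₂
  rw [mul_comm t b₁, e₁, mul_comm q t, e₂, mul_div_mul_left _ _ hq0,
    show t * q * b₂ / (q * x₂) = t * b₂ / x₂ by field_simp]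
  generalize 1 - b₁ * t / x₁ = d at h
  generalize 1 - t * q / x₁ = d'
  field_simp

end Quotients

/-- The factor of `Φ φ_s` attached to a single variable. -/
def singleFactor (τ x₁ x₂ β₁ β₂ : ℂ) (t : ℂ) : ℂ :=
  1 / (qPochInf (t * qPow τ β₁ / x₁) (qPow τ 1) * qPochInf (t * qPow τ β₂ / x₂) (qPow τ 1)) *
    (qPochInf (qPow τ 1 * t / x₁) (qPow τ 1) * qPochInf (qPow τ 1 * t / x₂) (qPow τ 1))

/-- The factor of `Φ` attached to a pair of variables. -/
def pairFactor (τ γ u v : ℂ) : ℂ :=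
  qPochInf (qPow τ (1 - γ) * v / u) (qPow τ 1) / qPochInf (qPow τ γ * v / u) (qPow τ 1)

lemma PhiReg_eq {n : ℕ} (τ α γ x₁ x₂ β₁ β₂ : ℂ) (X : Fin n → ℂ) :
    PhiReg τ α γ x₁ x₂ β₁ β₂ X =
      (∏ j : Fin n, qPow τ ((α - n + (j.val + 1) - 2 * j.val * γ) * X j)) *
        (∏ j, singleFactor τ x₁ x₂ β₁ β₂ (qPow τ (X j))) *
        ∏ i, ∏ j ∈ Ioi i, pairFactor τ γ (qPow τ (X i)) (qPow τ (X j)) := by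
  unfold PhiReg PhiCore singleFactor pairFactor
  rw [Finset.prod_mul_distrib (f := fun j => 1 / _)]
  ring

/-- A term of the alternating sum, with its sign, as a product over variables and pairs of
variables. -/
lemma sign_mul_PhiReg_mul_matsuoNumTerm {n : ℕ} (τ α γ x₁ x₂ β₁ β₂ y₁ y₂ b₁ : ℂ) (l : ℕ)
    (σ : Equiv.Perm (Fin n)) (X : Fin n → ℂ) :
    ((Equiv.Perm.sign σ : ℤ) : ℂ) * (PhiReg τ α γ x₁ x₂ β₁ β₂ X *
        matsuoNumTerm τ γ y₁ y₂ b₁ l ((fun j => qPow τ (X j)) ∘ σ)) =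
      (∏ j : Fin n, qPow τ ((α - n + (j.val + 1) - 2 * j.val * γ) * X j)) *
        (∏ j, (singleFactor τ x₁ x₂ β₁ β₂ (qPow τ (X j)) *
          if (σ.symm j).val < l then 1 - qPow τ b₁ * qPow τ (X j) / y₁
            else 1 - qPow τ (X j) / y₂)) *
        ∏ i, ∏ j ∈ Ioi i, (pairFactor τ γ (qPow τ (X i)) (qPow τ (X j)) *
          if σ.symm i < σ.symm j then qPow τ (X i) - qPow τ (-γ) * qPow τ (X j)
            else -(qPow τ (X j) - qPow τ (-γ) * qPow τ (X i))) := by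
  have h := sign_mul_qVand_comp τ γ σ (fun j => qPow τ (X j))
  have h' : (∏ k : Fin n, if k.val < l then 1 - qPow τ b₁ * ((fun j => qPow τ (X j)) ∘ σ) k / y₁
        else 1 - ((fun j => qPow τ (X j)) ∘ σ) k / y₂) =
      ∏ j : Fin n, if (σ.symm j).val < l then 1 - qPow τ b₁ * qPow τ (X j) / y₁
        else 1 - qPow τ (X j) / y₂ := by
    rw [← Equiv.prod_comp σ (fun j => if (σ.symm j).val < l then
      1 - qPow τ b₁ * qPow τ (X j) / y₁ else 1 - qPow τ (X j) / y₂)]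
    simp
  simp only [Finset.prod_mul_distrib]
  rw [← h, ← h', PhiReg_eq]
  unfold matsuoNumTerm
  ring

/-- The permutation moving the last `s` positions in front of the first `n - s`. -/
def blockRotate (n s : ℕ) (hs : s ≤ n) : Equiv.Perm (Fin n) where
  toFun k := if h : k.val < s then ⟨n - s + k.val, by omega⟩ else ⟨k.val - s, by omega⟩
  invFun k := if h : k.val < n - s then ⟨k.val + s, by omega⟩ else ⟨k.val - (n - s), by omega⟩
  left_inv k := by
    ext
    by_cases h : k.val < s
    · simp [h]
    · have : k.val - s < n - s := by omega
      simp [h, this]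
      omega
  right_inv k := by
    ext
    by_cases h : k.val < n - s
    · simp [h]
    · have : k.val - (n - s) < s := by omega
      simp [h, this]
      omega

lemma blockRotate_symm_val (n s : ℕ) (hs : s ≤ n) (k : Fin n) :
    ((blockRotate n s hs).symm k).val =
      if k.val < n - s then k.val + s else k.val - (n - s) := by
  change (if h : k.val < n - s then (⟨k.val + s, _⟩ : Fin n) else ⟨k.val - (n - s), _⟩).val = _
  split_ifs <;> rfl

/-- The indicator of the variables in the last `s` positions of the order given by `σ`. -/
def lastBlock {n : ℕ} (s : ℕ) (σ : Equiv.Perm (Fin n)) (j : Fin n) : ℤ :=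
  if (σ.symm j).val < n - s then 0 else 1

lemma sum_lastBlock {n s : ℕ} (hs : s ≤ n) (σ : Equiv.Perm (Fin n)) :
    ∑ j, (lastBlock s σ j : ℂ) = s := by
  have h : ∑ j, (lastBlock s σ j : ℂ) = ∑ k : Fin n, (1 - if k.val < n - s then (1 : ℂ) else 0) := by
    rw [← Equiv.sum_comp σ]
    refine Finset.sum_congr rfl fun k _ => ?_
    unfold lastBlock
    simp only [Equiv.symm_apply_apply]
    split_ifs <;> simp
  rw [h, Finset.sum_sub_distrib, Finset.sum_boole, Fin.card_filter_val_lt]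
  simp [hs]

lemma sum_Ioi_right {n : ℕ} (f : Fin n → ℂ) :
    ∑ i : Fin n, ∑ j ∈ Ioi i, f j = ∑ j : Fin n, (j.val : ℂ) * f j := by
  rw [Finset.sum_comm' (t' := univ) (s' := fun j => Iio j) (by simp)]
  simp

lemma sum_Ioi_left {n : ℕ} (f : Fin n → ℂ) :
    ∑ i : Fin n, ∑ _j ∈ Ioi i, f i = ∑ j : Fin n, ((n : ℂ) - 1 - j.val) * f j := by
  refine Finset.sum_congr rfl fun i _ => ?_
  have h : ((n - 1 - i.val : ℕ) : ℂ) = (n : ℂ) - 1 - i.val := by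
    rw [eq_sub_iff_add_eq, eq_sub_iff_add_eq]
    exact_mod_cast (by omega : n - 1 - i.val + i.val + 1 = n)
  rw [Finset.sum_const, Fin.card_Ioi, nsmul_eq_mul, h]

/-- With `j` counted from `0`, a shifted variable contributes its exponent in `Φ`, plus `j γ` from
the pairs where it comes second, plus `(n - 1 - j) (1 - γ)` from those where it comes first. The sum
is `α - (n - 1) γ` for every `j`, so the constant depends on `s` only. -/
lemma prod_shift_constants {n s : ℕ} (hs : s ≤ n) (τ α γ : ℂ) (σ : Equiv.Perm (Fin n)) :
    (∏ j : Fin n, qPow τ ((α - n + (j.val + 1) - 2 * j.val * γ) * lastBlock s σ j)) *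
      ∏ i : Fin n, ∏ j ∈ Ioi i, qPow τ (γ * lastBlock s σ j + (1 - γ) * lastBlock s σ i) =
      qPow τ ((α - (n - 1) * γ) * s) := by
  simp only [← qPow_sum]
  rw [← qPow_add]
  congr 1
  simp only [Finset.sum_add_distrib]
  rw [sum_Ioi_right (fun j => γ * lastBlock s σ j),
    sum_Ioi_left (fun j => (1 - γ) * lastBlock s σ j), ← sum_lastBlock hs σ, Finset.mul_sum,
    ← Finset.sum_add_distrib, ← Finset.sum_add_distrib]
  exact Finset.sum_congr rfl fun j _ => by ring

section Shift

variable {n : ℕ} {τ γ x₁ x₂ β₁ β₂ : ℂ} {X : Fin n → ℂ}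

lemma AvoidsPoles.add_int (h : AvoidsPoles τ γ x₁ x₂ β₁ β₂ X) (ν : Fin n → ℤ) :
    AvoidsPoles τ γ x₁ x₂ β₁ β₂ (fun j => X j + ν j) := by
  refine ⟨fun j m => ?_, fun i j m hij => ?_⟩
  · have := h.1 j (ν j + m)
    push_cast at this
    refine ⟨fun e => this.1 ?_, fun e => this.2 ?_⟩ <;> rw [← e] <;> congr 1 <;> ring
  · have := h.2 i j (ν j + m - ν i) hij
    push_cast at this
    refine fun e => this ?_
    have e' : qPow τ (X j + γ + (ν j + m - ν i)) = qPow τ (X j + ν j + γ + m) / qPow τ (ν i) := by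
      rw [← qPow_sub]
      congr 1
      ring
    rw [e', e, qPow_add, mul_div_cancel_right₀ _ (qPow_ne_zero _ _)]

lemma AvoidsPoles.one_sub_ne_zero₁ (hx₁ : x₁ ≠ 0) (h : AvoidsPoles τ γ x₁ x₂ β₁ β₂ X)
    (j : Fin n) : 1 - qPow τ β₁ * qPow τ (X j) / x₁ ≠ 0 := by
  refine one_sub_div_ne_zero hx₁ ?_
  have := (h.1 j 0).1
  rwa [Int.cast_zero, add_zero, qPow_add, mul_comm] at this

lemma AvoidsPoles.one_sub_ne_zero₂ (hx₂ : x₂ ≠ 0) (h : AvoidsPoles τ γ x₁ x₂ β₁ β₂ X)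
    (j : Fin n) : 1 - qPow τ β₂ * qPow τ (X j) / (qPow τ 1 * x₂) ≠ 0 := by
  refine one_sub_div_ne_zero (mul_ne_zero (qPow_ne_zero _ _) hx₂) fun e => ?_
  refine (h.1 j (-1)).2 ?_
  rw [qPow_add, qPow_add, mul_comm (qPow τ (X j)), e]
  push_cast
  rw [qPow_neg, mul_comm, inv_mul_cancel_left₀ (qPow_ne_zero _ _)]

/-- The shift of the variables in the last block of the order given by `σ` turns the term of
`Φ φ_s` at `q x₂` attached to `σ` into a term of `Φ ψ_{n - s}`. -/
lemma term_shift (hτ : 0 < τ.im) (hx₁ : x₁ ≠ 0) (hx₂ : x₂ ≠ 0) (α : ℂ)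
    (hX : AvoidsPoles τ γ x₁ x₂ β₁ β₂ X) {s : ℕ} (hs : s ≤ n) (σ : Equiv.Perm (Fin n)) :
    ((Equiv.Perm.sign σ : ℤ) : ℂ) *
      (PhiReg τ α γ x₁ (qPow τ 1 * x₂) β₁ β₂ (fun j => X j + lastBlock s σ j) *
        matsuoNumTerm τ γ (qPow τ 1 * x₂) x₁ β₂ (n - s)
          ((fun j => qPow τ (X j + lastBlock s σ j)) ∘ σ)) =
      qPow τ ((α - (n - 1) * γ) * s) *
        (((Equiv.Perm.sign (σ * blockRotate n s hs) : ℤ) : ℂ) *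
          (PhiReg τ α γ x₁ x₂ β₁ β₂ X * matsuoNumTerm τ γ x₁ x₂ β₁ s
            ((fun j => qPow τ (X j)) ∘ (σ * blockRotate n s hs : Equiv.Perm (Fin n))))) := by
  have hq := norm_qPow_one_lt hτ
  have hq0 := qPow_ne_zero τ 1
  rw [sign_mul_PhiReg_mul_matsuoNumTerm, sign_mul_PhiReg_mul_matsuoNumTerm,
    ← prod_shift_constants hs τ α γ σ]
  have hpos : ∀ j, (((σ * blockRotate n s hs : Equiv.Perm (Fin n)).symm j).val =
      if (σ.symm j).val < n - s then (σ.symm j).val + s else (σ.symm j).val - (n - s)) :=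
    fun j => blockRotate_symm_val n s hs (σ.symm j)
  have e₁ : (∏ j : Fin n, qPow τ ((α - n + (j.val + 1) - 2 * j.val * γ) *
      (X j + lastBlock s σ j))) =
      (∏ j : Fin n, qPow τ ((α - n + (j.val + 1) - 2 * j.val * γ) * lastBlock s σ j)) *
      ∏ j : Fin n, qPow τ ((α - n + (j.val + 1) - 2 * j.val * γ) * X j) := by
    rw [← Finset.prod_mul_distrib]
    refine Finset.prod_congr rfl fun j _ => ?_
    rw [← qPow_add]
    congr 1
    ring
  have e₂ : (∏ j : Fin n, (singleFactor τ x₁ (qPow τ 1 * x₂) β₁ β₂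
      (qPow τ (X j + lastBlock s σ j)) *
        if (σ.symm j).val < n - s
          then 1 - qPow τ β₂ * qPow τ (X j + lastBlock s σ j) / (qPow τ 1 * x₂)
          else 1 - qPow τ (X j + lastBlock s σ j) / x₁)) =
      ∏ j : Fin n, (singleFactor τ x₁ x₂ β₁ β₂ (qPow τ (X j)) *
        if ((σ * blockRotate n s hs : Equiv.Perm (Fin n)).symm j).val < s
          then 1 - qPow τ β₁ * qPow τ (X j) / x₁ else 1 - qPow τ (X j) / x₂) := by
    refine Finset.prod_congr rfl fun j _ => ?_
    rw [hpos]
    unfold singleFactor lastBlock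
    by_cases h : (σ.symm j).val < n - s
    · rw [if_pos h, if_pos h, if_pos h, if_neg (by omega), Int.cast_zero, add_zero]
      exact single_unshifted hq hq0 (hX.one_sub_ne_zero₂ hx₂ j)
    · rw [if_neg h, if_neg h, if_neg h, if_pos (by omega), Int.cast_one, qPow_add]
      exact single_shifted hq hq0 (hX.one_sub_ne_zero₁ hx₁ j)
  have e₃ : (∏ i : Fin n, ∏ j ∈ Ioi i, (pairFactor τ γ (qPow τ (X i + lastBlock s σ i))
      (qPow τ (X j + lastBlock s σ j)) * if σ.symm i < σ.symm j
        then qPow τ (X i + lastBlock s σ i) - qPow τ (-γ) * qPow τ (X j + lastBlock s σ j)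
        else -(qPow τ (X j + lastBlock s σ j) - qPow τ (-γ) * qPow τ (X i + lastBlock s σ i)))) =
      (∏ i : Fin n, ∏ j ∈ Ioi i, qPow τ (γ * lastBlock s σ j + (1 - γ) * lastBlock s σ i)) *
      ∏ i : Fin n, ∏ j ∈ Ioi i, (pairFactor τ γ (qPow τ (X i)) (qPow τ (X j)) *
        if (σ * blockRotate n s hs : Equiv.Perm (Fin n)).symm i <
            (σ * blockRotate n s hs : Equiv.Perm (Fin n)).symm j
          then qPow τ (X i) - qPow τ (-γ) * qPow τ (X j)
          else -(qPow τ (X j) - qPow τ (-γ) * qPow τ (X i))) := by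
    simp only [← Finset.prod_mul_distrib]
    refine Finset.prod_congr rfl fun i _ => Finset.prod_congr rfl fun j hj => ?_
    have hij : i < j := Finset.mem_Ioi.mp hj
    -- Used with `m = 0` when only `t_j` is shifted and with `m = 1` when only `t_i` is.
    have hpole : ∀ m : ℤ, 1 - qPow τ γ * qPow τ (X j) / (qPow τ (X i) * qPow τ m) ≠ 0 := by
      intro m
      refine one_sub_div_ne_zero (mul_ne_zero (qPow_ne_zero _ _) (qPow_ne_zero _ _)) fun e => ?_
      refine hX.2 i j (-m) hij ?_
      rw [qPow_add, qPow_add, mul_comm (qPow τ (X j)), e]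
      push_cast
      rw [qPow_neg, mul_assoc, mul_inv_cancel₀ (qPow_ne_zero _ _), mul_one]
    have hlt : ((σ * blockRotate n s hs : Equiv.Perm (Fin n)).symm i <
            (σ * blockRotate n s hs : Equiv.Perm (Fin n)).symm j) ↔
        (if (σ.symm i).val < n - s then (σ.symm i).val + s else (σ.symm i).val - (n - s)) <
        (if (σ.symm j).val < n - s then (σ.symm j).val + s else (σ.symm j).val - (n - s)) := by
      rw [Fin.lt_def, hpos, hpos]
    have hlt' : σ.symm i < σ.symm j ↔ (σ.symm i).val < (σ.symm j).val := Iff.rfl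
    have hi := (σ.symm i).isLt
    have hj' := (σ.symm j).isLt
    simp only [hlt, hlt']
    unfold pairFactor lastBlock
    -- The rotation reverses the relative order of two variables exactly when they lie in different
    -- blocks, which matches the exchange made by `pair_shift_right` and `pair_shift_left`. A pair
    -- shifted as a whole only gains the factor `q` by homogeneity.
    by_cases h₁ : (σ.symm i).val < n - s <;> by_cases h₂ : (σ.symm j).val < n - s
    · simp only [if_pos h₁, if_pos h₂, Int.cast_zero, add_zero, mul_zero, qPow_zero, one_mul,
        add_lt_add_iff_right]
    · simp only [if_pos h₁, if_neg h₂, Int.cast_zero, Int.cast_one, add_zero, mul_zero, mul_one]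
      rw [if_pos (by omega), if_neg (by omega), qPow_add, qPow_sub, qPow_neg]
      refine pair_shift_right hq (qPow_ne_zero _ _) (qPow_ne_zero _ _) ?_
      simpa using hpole 0
    · simp only [if_neg h₁, if_pos h₂, Int.cast_zero, Int.cast_one, zero_add, add_zero, mul_zero,
        mul_one]
      rw [if_neg (by omega), if_pos (by omega), qPow_add, qPow_sub, qPow_neg]
      refine pair_shift_left hq hq0 (qPow_ne_zero _ _) (qPow_ne_zero _ _) ?_
      simpa using hpole 1
    · simp only [if_neg h₁, if_neg h₂, Int.cast_one, mul_one]
      have : (σ.symm i).val - (n - s) < (σ.symm j).val - (n - s) ↔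
          (σ.symm i).val < (σ.symm j).val := by omega
      simp only [this, qPow_add _ _ 1, pair_shift_both hq0, add_sub_cancel]
      split_ifs <;> ring
  rw [e₁, e₂, e₃]
  ring

end Shift

/-! ### The q-difference system. -/

section System

variable {n : ℕ} {τ γ x₁ x₂ β₁ β₂ : ℂ}

/-- The signed terms of the Jackson sums of `Φ ψ_{(s, n - s)}[y₁, y₂; b₁, b₂]`, `l = n - s`. -/
def jacksonTerm (τ α γ x₁ x₂ β₁ β₂ y₁ y₂ b₁ : ℂ) (l : ℕ) (X : Fin n → ℂ)
    (σ : Equiv.Perm (Fin n)) (ν : Fin n → ℤ) : ℂ :=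
  ((Equiv.Perm.sign σ : ℤ) : ℂ) * (PhiReg τ α γ x₁ x₂ β₁ β₂ (fun j => X j + ν j) *
    matsuoNumTerm τ γ y₁ y₂ b₁ l ((fun j => qPow τ (X j + ν j)) ∘ σ))

lemma sum_jacksonTerm (α y₁ y₂ b₁ : ℂ) (s : ℕ) (X : Fin n → ℂ) (ν : Fin n → ℤ) :
    ∑ σ, jacksonTerm τ α γ x₁ x₂ β₁ β₂ y₁ y₂ b₁ (n - s) X σ ν =
      PhiReg τ α γ x₁ x₂ β₁ β₂ (fun j => X j + ν j) *
        matsuoNum τ γ y₁ y₂ b₁ s (fun j => qPow τ (X j + ν j)) := by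
  unfold jacksonTerm matsuoNum altSum
  rw [Finset.mul_sum]
  exact Finset.sum_congr rfl fun σ _ => by ring

lemma Converges.summable_jacksonTerm {α : ℂ} {X : Fin n → ℂ}
    (h : Converges τ α γ x₁ x₂ β₁ β₂ X) (s : Fin (n + 1)) (σ : Equiv.Perm (Fin n)) :
    Summable (jacksonTerm τ α γ x₁ x₂ β₁ β₂ x₂ x₁ β₂ (n - s.val) X σ) :=
  (h s σ).mul_left _

lemma jacksonTerm_shift (hτ : 0 < τ.im) (hx₁ : x₁ ≠ 0) (hx₂ : x₂ ≠ 0) (α : ℂ) {X : Fin n → ℂ}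
    (hX : AvoidsPoles τ γ x₁ x₂ β₁ β₂ X) {s : ℕ} (hs : s ≤ n) (σ : Equiv.Perm (Fin n))
    (ν : Fin n → ℤ) :
    jacksonTerm τ α γ x₁ (qPow τ 1 * x₂) β₁ β₂ (qPow τ 1 * x₂) x₁ β₂ (n - s) X σ
        (ν + lastBlock s σ) =
      qPow τ ((α - (n - 1) * γ) * s) *
        jacksonTerm τ α γ x₁ x₂ β₁ β₂ x₁ x₂ β₁ s X (σ * blockRotate n s hs) ν := by
  have := term_shift hτ hx₁ hx₂ α (hX.add_int ν) hs σ
  unfold jacksonTerm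
  rw [← this]
  simp only [Pi.add_apply, Int.cast_add, add_assoc]

/-- The translation of the lattice depends on `σ`, so the sums over `σ` and over the lattice must be
exchanged before translating; this is why convergence is required of each term separately.
Reindexing `σ` by the rotation then produces the integral of `Φ ψ_{n-s}`, which `R` expands in the
`φ̃_r`. -/
lemma phiTilde_shift (hτ : 0 < τ.im) (hx₁ : x₁ ≠ 0) (hx₂ : x₂ ≠ 0) (α : ℂ)
    {R : Matrix (Fin (n + 1)) (Fin (n + 1)) ℂ}
    (hR : ∀ (t : Fin n → ℂ) (j : Fin (n + 1)),
      ∑ i : Fin (n + 1), matsuoNum τ γ x₂ x₁ β₂ i.val t * R i j =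
        matsuoNum τ γ x₁ x₂ β₁ (n - j.val) t)
    {X : Fin n → ℂ} (hX : AvoidsPoles τ γ x₁ x₂ β₁ β₂ X) (hc : Converges τ α γ x₁ x₂ β₁ β₂ X)
    (hc' : Converges τ α γ x₁ (qPow τ 1 * x₂) β₁ β₂ X) (s : Fin (n + 1)) :
    phiTilde τ α γ x₁ (qPow τ 1 * x₂) β₁ β₂ s.val X =
      ∑ r : Fin (n + 1), phiTilde τ α γ x₁ x₂ β₁ β₂ r.val X *
        (R r s * qPow τ ((α - (n - 1) * γ) * s.val)) := by
  have hs : s.val ≤ n := Nat.lt_succ_iff.mp s.isLt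
  set c := qPow τ ((α - (n - 1) * γ) * s.val) with hcdef
  have hc0 : c ≠ 0 := qPow_ne_zero _ _
  set f := jacksonTerm τ α γ x₁ (qPow τ 1 * x₂) β₁ β₂ (qPow τ 1 * x₂) x₁ β₂ (n - s.val) X with hf
  set g := jacksonTerm τ α γ x₁ x₂ β₁ β₂ x₁ x₂ β₁ s.val X with hg
  have hfg : ∀ σ ν, f σ (ν + lastBlock s.val σ) = c * g (σ * blockRotate n s.val hs) ν :=
    fun σ ν => jacksonTerm_shift hτ hx₁ hx₂ α hX hs σ ν
  have hfs : ∀ σ, Summable (f σ) := fun σ => hc'.summable_jacksonTerm s σ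
  -- Convergence of the terms of `Φ ψ_{n-s}` is not assumed; it is carried back along the shift from
  -- the terms of `Φ φ_s` at `q x₂`.
  have hgs : ∀ σ, Summable (g σ) := by
    intro σ
    have h := (Equiv.addRight (lastBlock s.val (σ * (blockRotate n s.val hs)⁻¹))).summable_iff.mpr
      (hfs (σ * (blockRotate n s.val hs)⁻¹))
    have e : (f (σ * (blockRotate n s.val hs)⁻¹) ∘
        ⇑(Equiv.addRight (lastBlock s.val (σ * (blockRotate n s.val hs)⁻¹)))) =
        fun ν => c * g σ ν := by
      funext ν
      simp only [Function.comp_apply, Equiv.coe_addRight, hfg, inv_mul_cancel_right]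
    rw [e] at h
    exact (summable_mul_left_iff hc0).mp h
  have h₁ : ∑' ν : Fin n → ℤ, PhiReg τ α γ x₁ (qPow τ 1 * x₂) β₁ β₂ (fun j => X j + ν j) *
      matsuoNum τ γ (qPow τ 1 * x₂) x₁ β₂ s.val (fun j => qPow τ (X j + ν j)) =
      c * ∑' ν : Fin n → ℤ, PhiReg τ α γ x₁ x₂ β₁ β₂ (fun j => X j + ν j) *
        matsuoNum τ γ x₁ x₂ β₁ (n - s.val) (fun j => qPow τ (X j + ν j)) := by
    simp only [← sum_jacksonTerm]
    rw [show n - (n - s.val) = s.val by omega]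
    change ∑' ν, ∑ σ, f σ ν = c * ∑' ν, ∑ σ, g σ ν
    rw [Summable.tsum_finsetSum fun σ _ => hfs σ, Summable.tsum_finsetSum fun σ _ => hgs σ,
      ← Equiv.sum_comp (Equiv.mulRight (blockRotate n s.val hs)) (fun σ => ∑' ν, g σ ν),
      Finset.mul_sum]
    refine Finset.sum_congr rfl fun σ _ => ?_
    rw [← (Equiv.addRight (lastBlock s.val σ)).tsum_eq, ← tsum_mul_left]
    exact tsum_congr fun ν => hfg σ ν
  have h₂ : ∀ r : Fin (n + 1), Summable fun ν : Fin n → ℤ =>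
      PhiReg τ α γ x₁ x₂ β₁ β₂ (fun j => X j + ν j) *
        matsuoNum τ γ x₂ x₁ β₂ r.val (fun j => qPow τ (X j + ν j)) := by
    intro r
    simp only [← sum_jacksonTerm]
    exact summable_sum fun σ _ => hc.summable_jacksonTerm r σ
  have h₃ : ∑' ν : Fin n → ℤ, PhiReg τ α γ x₁ x₂ β₁ β₂ (fun j => X j + ν j) *
        matsuoNum τ γ x₁ x₂ β₁ (n - s.val) (fun j => qPow τ (X j + ν j)) =
      ∑ r : Fin (n + 1), (∑' ν : Fin n → ℤ, PhiReg τ α γ x₁ x₂ β₁ β₂ (fun j => X j + ν j) *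
        matsuoNum τ γ x₂ x₁ β₂ r.val (fun j => qPow τ (X j + ν j))) * R r s := by
    simp only [← tsum_mul_right]
    rw [← Summable.tsum_finsetSum fun r _ => (h₂ r).mul_right _]
    refine tsum_congr fun ν => ?_
    rw [← hR, Finset.mul_sum]
    exact Finset.sum_congr rfl fun r _ => by ring
  unfold phiTilde jackson
  rw [h₁, h₃, Finset.mul_sum, Finset.mul_sum]
  exact Finset.sum_congr rfl fun r _ => by ring

lemma sum_fin_val (n : ℕ) : ∑ s : Fin (n + 1), (s.val : ℂ) = n * (n + 1) / 2 := by
  rw [Fin.sum_univ_eq_sum_range (fun s => (s : ℂ))]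
  induction n with
  | zero => simp
  | succ n ih =>
    rw [Finset.sum_range_succ, ih]
    push_cast
    ring

lemma exists_representsSystem (hτ : 0 < τ.im) (hx₁ : x₁ ≠ 0) (hx₂ : x₂ ≠ 0) (α : ℂ)
    {R : Matrix (Fin (n + 1)) (Fin (n + 1)) ℂ}
    (hR : ∀ (t : Fin n → ℂ) (j : Fin (n + 1)),
      ∑ i : Fin (n + 1), matsuoNum τ γ x₂ x₁ β₂ i.val t * R i j =
        matsuoNum τ γ x₁ x₂ β₁ (n - j.val) t) :
    ∃ K, RepresentsSystem n τ α γ x₁ x₂ β₁ β₂ K ∧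
      K.det = qPow τ ((α - (n - 1) * γ) * (n * (n + 1) / 2)) * R.det := by
  refine ⟨R * Matrix.diagonal fun s => qPow τ ((α - (n - 1) * γ) * s.val), ?_, ?_⟩
  · intro X hX hc hc' s
    simp only [Matrix.mul_diagonal]
    exact phiTilde_shift hτ hx₁ hx₂ α hR hX hc hc' s
  · rw [Matrix.det_mul, Matrix.det_diagonal, ← qPow_sum, ← Finset.mul_sum, sum_fin_val, mul_comm]

end System

/-! ### Bounds for infinite q-products. -/

section Pochhammer

variable {c : ℂ}

lemma norm_qPoch_le (hc : ‖c‖ < 1) (x : ℂ) (r : ℕ) :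
    ‖qPoch x c r‖ ≤ Real.exp (‖x‖ * (1 - ‖c‖)⁻¹) := by
  have h := Finset.norm_prod_one_add_sub_one_le (range r) (fun ν => -(c ^ ν * x))
  have h₁ : ∑ ν ∈ range r, ‖-(c ^ ν * x)‖ ≤ ‖x‖ * (1 - ‖c‖)⁻¹ := by
    simp only [norm_neg, norm_mul, norm_pow]
    rw [← Finset.sum_mul, mul_comm, ← tsum_geometric_of_lt_one (norm_nonneg c) hc]
    gcongr
    exact (summable_geometric_of_lt_one (norm_nonneg c) hc).sum_le_tsum _
      (fun _ _ => pow_nonneg (norm_nonneg c) _)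
  simp only [← sub_eq_add_neg] at h
  have h₂ := norm_sub_norm_le (∏ ν ∈ range r, (1 - c ^ ν * x)) 1
  rw [norm_one] at h₂
  exact le_trans (by unfold qPoch; linarith) (Real.exp_le_exp.mpr h₁)

lemma summable_norm_pow_mul (hc : ‖c‖ < 1) (x : ℂ) : Summable fun ν : ℕ => ‖-(c ^ ν * x)‖ := by
  simp only [norm_neg, norm_mul, norm_pow]
  exact (summable_geometric_of_lt_one (norm_nonneg c) hc).mul_right _

lemma tendsto_qPoch (hc : ‖c‖ < 1) (x : ℂ) :
    Filter.Tendsto (qPoch x c) Filter.atTop (nhds (qPochInf x c)) := by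
  have h : Multipliable fun ν : ℕ => 1 + -(c ^ ν * x) :=
    multipliable_one_add_of_summable (summable_norm_pow_mul hc x)
  simp only [← sub_eq_add_neg] at h
  exact h.hasProd.tendsto_prod_nat

lemma norm_qPochInf_le (hc : ‖c‖ < 1) (x : ℂ) :
    ‖qPochInf x c‖ ≤ Real.exp (‖x‖ * (1 - ‖c‖)⁻¹) :=
  le_of_tendsto' (tendsto_qPoch hc x).norm fun r => norm_qPoch_le hc x r

lemma qPochInf_ne_zero (hc : ‖c‖ < 1) {x : ℂ} (h : ∀ k : ℕ, c ^ k * x ≠ 1) :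
    qPochInf x c ≠ 0 := by
  have := tprod_one_add_ne_zero_of_summable (f := fun ν : ℕ => -(c ^ ν * x))
    (fun k e => h k (by linear_combination -e)) (summable_norm_pow_mul hc x)
  simp only [← sub_eq_add_neg] at this
  exact this

lemma exists_norm_qPochInf_mul_pow_le (hc : ‖c‖ < 1) (x : ℂ) :
    ∃ C : ℝ, 0 ≤ C ∧ ∀ m : ℕ, ‖qPochInf (x * c ^ m) c‖ ≤ C := by
  refine ⟨Real.exp (‖x‖ * (1 - ‖c‖)⁻¹), (Real.exp_pos _).le, fun m => ?_⟩
  refine (norm_qPochInf_le hc _).trans (Real.exp_le_exp.mpr ?_)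
  have h1 : 0 ≤ (1 - ‖c‖)⁻¹ := inv_nonneg.mpr (by linarith)
  have h2 : ‖x * c ^ m‖ ≤ ‖x‖ := by
    rw [norm_mul, norm_pow]
    exact mul_le_of_le_one_right (norm_nonneg _) (pow_le_one₀ (norm_nonneg _) hc.le)
  exact mul_le_mul_of_nonneg_right h2 h1

/-- The reciprocal equals `(x; c)_m / (x; c)_∞`, and the finite products are bounded uniformly in
`m`. -/
lemma exists_norm_inv_qPochInf_mul_pow_le (hc : ‖c‖ < 1) {x : ℂ} (hx : qPochInf x c ≠ 0) :
    ∃ C : ℝ, 0 ≤ C ∧ ∀ m : ℕ, ‖(qPochInf (x * c ^ m) c)⁻¹‖ ≤ C := by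
  refine ⟨Real.exp (‖x‖ * (1 - ‖c‖)⁻¹) * ‖(qPochInf x c)⁻¹‖, by positivity, fun m => ?_⟩
  have h := qPoch_eq hc x m
  have hm : qPochInf (x * c ^ m) c ≠ 0 := fun e => hx (by rw [h, e, mul_zero])
  have e : (qPochInf (x * c ^ m) c)⁻¹ = qPoch x c m * (qPochInf x c)⁻¹ := by
    have hm' : qPoch x c m ≠ 0 := fun e => hx (by rw [h, e, zero_mul])
    rw [h]
    field_simp
  rw [e, norm_mul]
  exact mul_le_mul_of_nonneg_right (norm_qPoch_le hc x m) (norm_nonneg _)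

/-- For `m ≥ 0` numerator and reciprocal denominator are bounded. Each step to a more negative `m`
multiplies the quotient by some `(c ^ (p + 1) - a) / (c ^ (p + 1) - b)`; these ratios converge to `a
/ b`, hence are bounded, and growth is at most geometric although both products alone may grow
faster. -/
lemma exists_norm_qPochInf_div_le (hc : ‖c‖ < 1) (hc0 : c ≠ 0) (a b : ℂ) (hb0 : b ≠ 0)
    (hb : ∀ m : ℤ, c ^ m * b ≠ 1) :
    ∃ C M : ℝ, 0 ≤ C ∧ 1 ≤ M ∧ ∀ m : ℤ,
      ‖qPochInf (a * c ^ m) c / qPochInf (b * c ^ m) c‖ ≤ C * M ^ m.natAbs := by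
  obtain ⟨A, hA0, hA⟩ := exists_norm_qPochInf_mul_pow_le hc a
  obtain ⟨B, hB0, hB⟩ := exists_norm_inv_qPochInf_mul_pow_le hc (x := b)
    (qPochInf_ne_zero hc fun k => by exact_mod_cast hb k)
  have hpos : ∀ m : ℕ,
      ‖qPochInf (a * c ^ (m : ℤ)) c / qPochInf (b * c ^ (m : ℤ)) c‖ ≤ A * B := by
    intro m
    rw [zpow_natCast, div_eq_mul_inv, norm_mul]
    exact mul_le_mul (hA m) (hB m) (norm_nonneg _) hA0
  have hratio : ∃ M : ℝ, ∀ p : ℕ, ‖(c ^ (p + 1) - a) / (c ^ (p + 1) - b)‖ ≤ M := by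
    have hlim : Filter.Tendsto (fun p : ℕ => c ^ (p + 1)) Filter.atTop (nhds 0) :=
      (Filter.tendsto_add_atTop_iff_nat 1).mpr (tendsto_pow_atTop_nhds_zero_of_norm_lt_one hc)
    have := (hlim.sub_const a).div (hlim.sub_const b) (by simpa using hb0)
    obtain ⟨M, hM⟩ := (Metric.isBounded_range_of_tendsto _ this).exists_norm_le
    exact ⟨M, fun p => hM _ ⟨p, rfl⟩⟩
  obtain ⟨M, hM⟩ := hratio
  have hneg : ∀ p : ℕ, ‖qPochInf (a * c ^ (-(p : ℤ))) c / qPochInf (b * c ^ (-(p : ℤ))) c‖ ≤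
      A * B * (max 1 M) ^ p := by
    intro p
    induction p with
    | zero => simpa using hpos 0
    | succ p ih =>
      have e : ∀ d : ℂ, c * (d * c ^ (-((p + 1 : ℕ) : ℤ))) = d * c ^ (-(p : ℤ)) := by
        intro d
        have : (-(p : ℤ)) = 1 + -((p + 1 : ℕ) : ℤ) := by push_cast; ring
        rw [this, zpow_add₀ hc0, zpow_one]
        ring
      have e' : ∀ d : ℂ, 1 - d * c ^ (-((p + 1 : ℕ) : ℤ)) = (c ^ (p + 1) - d) / c ^ (p + 1) := by
        intro d
        rw [zpow_neg, zpow_natCast]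
        field_simp
      rw [qPochInf_eq hc (a * c ^ (-((p + 1 : ℕ) : ℤ))),
        qPochInf_eq hc (b * c ^ (-((p + 1 : ℕ) : ℤ))), e, e, e', e', mul_div_mul_comm,
        div_div_div_cancel_right₀ (pow_ne_zero _ hc0), norm_mul, mul_comm]
      calc _ ≤ (A * B * max 1 M ^ p) * max 1 M :=
            mul_le_mul ih ((hM p).trans (le_max_right _ _)) (norm_nonneg _) (by positivity)
        _ = _ := by ring
  refine ⟨A * B, max 1 M, by positivity, le_max_left _ _, fun m => ?_⟩
  obtain ⟨k, rfl | rfl⟩ := m.eq_nat_or_neg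
  · refine (hpos k).trans (le_mul_of_one_le_right (by positivity) ?_)
    exact one_le_pow₀ (le_max_left _ _)
  · simpa using hneg k

/-- For `m ≤ 0` the factor with index `-m` is zero. This is the source of all support statements on
lattices. -/
lemma one_le_of_qPochInf_zpow_ne_zero (hc0 : c ≠ 0) {m : ℤ} (h : qPochInf (c ^ m) c ≠ 0) :
    1 ≤ m := by
  by_contra! hm
  refine h (tprod_of_exists_eq_zero ⟨(-m).toNat, ?_⟩)
  rw [← zpow_natCast, Int.toNat_of_nonneg (by omega), ← zpow_add₀ hc0]
  simp

end Pochhammer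

/-! ### Geometric growth of the summands on the cone of nonnegative exponents. -/

/-- At most geometric growth on the cone of nonnegative exponents. -/
def GeomBounded {n : ℕ} (f : (Fin n → ℤ) → ℂ) : Prop :=
  ∃ C M : ℝ, 0 ≤ C ∧ 1 ≤ M ∧ ∀ ν : Fin n → ℤ, (∀ j, 0 ≤ ν j) →
    ‖f ν‖ ≤ C * M ^ (∑ j, (ν j).toNat)

namespace GeomBounded

variable {n : ℕ} {f g : (Fin n → ℤ) → ℂ}

lemma of_le {C M : ℝ} (hC : 0 ≤ C) (hM : 1 ≤ M) (k : (Fin n → ℤ) → ℕ)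
    (hk : ∀ ν : Fin n → ℤ, (∀ j, 0 ≤ ν j) → k ν ≤ ∑ j, (ν j).toNat)
    (h : ∀ ν : Fin n → ℤ, (∀ j, 0 ≤ ν j) → ‖f ν‖ ≤ C * M ^ k ν) : GeomBounded f :=
  ⟨C, M, hC, hM, fun ν hν => (h ν hν).trans
    (mul_le_mul_of_nonneg_left (pow_le_pow_right₀ hM (hk ν hν)) hC)⟩

lemma const (a : ℂ) : GeomBounded (fun _ : Fin n → ℤ => a) :=
  ⟨‖a‖, 1, norm_nonneg _, le_rfl, fun ν _ => by simp⟩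

lemma mul (hf : GeomBounded f) (hg : GeomBounded g) : GeomBounded (fun ν => f ν * g ν) := by
  obtain ⟨C, M, hC, hM, h⟩ := hf
  obtain ⟨C', M', hC', hM', h'⟩ := hg
  refine ⟨C * C', M * M', by positivity, one_le_mul_of_one_le_of_one_le hM hM', fun ν hν => ?_⟩
  rw [norm_mul, mul_pow, mul_mul_mul_comm]
  exact mul_le_mul (h ν hν) (h' ν hν) (norm_nonneg _) (by positivity)

lemma add (hf : GeomBounded f) (hg : GeomBounded g) : GeomBounded (fun ν => f ν + g ν) := by
  obtain ⟨C, M, hC, hM, h⟩ := hf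
  obtain ⟨C', M', hC', hM', h'⟩ := hg
  refine ⟨C + C', M * M', by positivity, one_le_mul_of_one_le_of_one_le hM hM', fun ν hν => ?_⟩
  refine (norm_add_le _ _).trans ?_
  rw [add_mul]
  refine add_le_add ((h ν hν).trans ?_) ((h' ν hν).trans ?_)
  · exact mul_le_mul_of_nonneg_left
      (pow_le_pow_left₀ (by positivity) (le_mul_of_one_le_right (by positivity) hM') _) hC
  · exact mul_le_mul_of_nonneg_left
      (pow_le_pow_left₀ (by positivity) (le_mul_of_one_le_left (by positivity) hM) _) hC'

lemma sub (hf : GeomBounded f) (hg : GeomBounded g) : GeomBounded (fun ν => f ν - g ν) := by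
  have := hf.add ((const (-1)).mul hg)
  simpa only [neg_one_mul, ← sub_eq_add_neg] using this

lemma prod {ι : Type*} (s : Finset ι) {f : ι → (Fin n → ℤ) → ℂ}
    (h : ∀ i ∈ s, GeomBounded (f i)) : GeomBounded (fun ν => ∏ i ∈ s, f i ν) := by
  classical
  induction s using Finset.induction_on with
  | empty => simpa using const (n := n) 1
  | insert a s ha ih =>
    simp only [Finset.prod_insert ha]
    exact (h a (by simp)).mul (ih fun i hi => h i (by simp [hi]))

lemma sum {ι : Type*} (s : Finset ι) {f : ι → (Fin n → ℤ) → ℂ}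
    (h : ∀ i ∈ s, GeomBounded (f i)) : GeomBounded (fun ν => ∑ i ∈ s, f i ν) := by
  classical
  induction s using Finset.induction_on with
  | empty => simpa using const (n := n) 0
  | insert a s ha ih =>
    simp only [Finset.sum_insert ha]
    exact (h a (by simp)).add (ih fun i hi => h i (by simp [hi]))

lemma of_single {F : ℕ → ℂ} {C : ℝ} (hC : 0 ≤ C) (h : ∀ m, ‖F m‖ ≤ C) (j : Fin n) :
    GeomBounded (fun ν => F (ν j).toNat) :=
  of_le hC le_rfl (fun _ => 0) (fun _ _ => Nat.zero_le _) fun ν _ => by simpa using h _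

lemma congr_cone (hf : GeomBounded f) (h : ∀ ν : Fin n → ℤ, (∀ j, 0 ≤ ν j) → g ν = f ν) :
    GeomBounded g := by
  obtain ⟨C, M, hC, hM, h'⟩ := hf
  exact ⟨C, M, hC, hM, fun ν hν => (h ν hν).symm ▸ h' ν hν⟩

end GeomBounded

lemma qPow_intCast (τ : ℂ) (m : ℤ) : qPow τ m = qPow τ 1 ^ m := by
  rw [← qPow_int_mul, mul_one]

lemma qPow_natCast (τ : ℂ) (m : ℕ) : qPow τ m = qPow τ 1 ^ m := by
  rw [← qPow_nat_mul, mul_one]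

section Growth

variable {n : ℕ} {τ γ x₁ x₂ β₁ β₂ : ℂ} {X : Fin n → ℂ}

lemma qPow_add_intCast_of_nonneg (a : ℂ) {m : ℤ} (hm : 0 ≤ m) :
    qPow τ (a + m) = qPow τ a * qPow τ 1 ^ m.toNat := by
  rw [qPow_add, qPow_intCast, ← zpow_natCast, Int.toNat_of_nonneg hm]

lemma geomBounded_qPow (hτ : 0 < τ.im) (j : Fin n) :
    GeomBounded (fun ν => qPow τ (X j + ν j)) := by
  refine GeomBounded.congr_cone (f := fun ν => qPow τ (X j) * qPow τ 1 ^ (ν j).toNat)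
    (GeomBounded.of_single (F := fun m => qPow τ (X j) * qPow τ 1 ^ m) (norm_nonneg (qPow τ (X j)))
      (fun m => ?_) j) fun ν hν => qPow_add_intCast_of_nonneg _ (hν j)
  rw [norm_mul, norm_pow]
  exact mul_le_of_le_one_right (norm_nonneg _)
    (pow_le_one₀ (norm_nonneg _) (norm_qPow_one_lt hτ).le)

lemma toNat_le_sum (ν : Fin n → ℤ) (j : Fin n) : (ν j).toNat ≤ ∑ j, (ν j).toNat :=
  Finset.single_le_sum (f := fun j => (ν j).toNat) (fun _ _ => Nat.zero_le _) (Finset.mem_univ j)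

lemma geomBounded_qPow_mul (e : ℂ) (j : Fin n) :
    GeomBounded (fun ν => qPow τ (e * (X j + ν j))) := by
  refine GeomBounded.of_le (C := ‖qPow τ (e * X j)‖) (M := max 1 ‖qPow τ e‖) (norm_nonneg _)
    (le_max_left _ _) (fun ν => (ν j).toNat) (fun ν _ => toNat_le_sum ν j) fun ν hν => ?_
  have : e * (X j + ν j) = e * X j + (ν j).toNat * e := by
    have h : ((ν j : ℤ) : ℂ) = ((ν j).toNat : ℂ) := by
      conv_lhs => rw [← Int.toNat_of_nonneg (hν j)]
      exact Int.cast_natCast _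
    rw [h]
    ring
  rw [this, qPow_add, qPow_nat_mul, norm_mul, norm_pow]
  gcongr
  exact le_max_right _ _

lemma geomBounded_qPochInf (hτ : 0 < τ.im) (a : ℂ) (j : Fin n) :
    GeomBounded (fun ν => qPochInf (a * qPow τ (X j + ν j)) (qPow τ 1)) := by
  obtain ⟨C, hC, h⟩ := exists_norm_qPochInf_mul_pow_le (norm_qPow_one_lt hτ) (a * qPow τ (X j))
  refine (GeomBounded.of_single hC h j).congr_cone fun ν hν => ?_
  rw [qPow_add_intCast_of_nonneg _ (hν j), mul_assoc]

lemma geomBounded_inv_qPochInf (hτ : 0 < τ.im) (a : ℂ) (j : Fin n)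
    (ha : ∀ k : ℕ, qPow τ 1 ^ k * (a * qPow τ (X j)) ≠ 1) :
    GeomBounded (fun ν => (qPochInf (a * qPow τ (X j + ν j)) (qPow τ 1))⁻¹) := by
  obtain ⟨C, hC, h⟩ := exists_norm_inv_qPochInf_mul_pow_le (norm_qPow_one_lt hτ)
    (qPochInf_ne_zero (norm_qPow_one_lt hτ) ha)
  refine (GeomBounded.of_single hC h j).congr_cone fun ν hν => ?_
  rw [qPow_add_intCast_of_nonneg _ (hν j), mul_assoc]

lemma AvoidsPoles.pow_mul_ne_one₁ (hx₁ : x₁ ≠ 0) (h : AvoidsPoles τ γ x₁ x₂ β₁ β₂ X)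
    (j : Fin n) (k : ℕ) : qPow τ 1 ^ k * (qPow τ β₁ / x₁ * qPow τ (X j)) ≠ 1 := by
  intro e
  refine (h.1 j k).1 ?_
  rw [Int.cast_natCast, qPow_add, qPow_add, qPow_natCast]
  field_simp at e
  linear_combination e

lemma AvoidsPoles.pow_mul_ne_one₂ (hx₂ : x₂ ≠ 0) (h : AvoidsPoles τ γ x₁ x₂ β₁ β₂ X)
    (j : Fin n) (k : ℕ) : qPow τ 1 ^ k * (qPow τ β₂ / x₂ * qPow τ (X j)) ≠ 1 := by
  intro e
  refine (h.1 j k).2 ?_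
  rw [Int.cast_natCast, qPow_add, qPow_add, qPow_natCast]
  field_simp at e
  linear_combination e

lemma AvoidsPoles.zpow_mul_ne_one (h : AvoidsPoles τ γ x₁ x₂ β₁ β₂ X) {i j : Fin n} (hij : i < j)
    (m : ℤ) : qPow τ 1 ^ m * (qPow τ γ * qPow τ (X j) / qPow τ (X i)) ≠ 1 := by
  intro e
  refine h.2 i j m hij ?_
  rw [qPow_add, qPow_add, qPow_intCast]
  have := qPow_ne_zero τ (X i)
  field_simp at e
  linear_combination e

/-- The factor depends on `ν j - ν i` only, whose absolute value is at most `ν i + ν j` on the cone.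
-/
lemma geomBounded_pairFactor (hτ : 0 < τ.im) (h : AvoidsPoles τ γ x₁ x₂ β₁ β₂ X) {i j : Fin n}
    (hij : i < j) :
    GeomBounded (fun ν => pairFactor τ γ (qPow τ (X i + ν i)) (qPow τ (X j + ν j))) := by
  have hne : qPow τ γ * qPow τ (X j) / qPow τ (X i) ≠ 0 :=
    div_ne_zero (mul_ne_zero (qPow_ne_zero _ _) (qPow_ne_zero _ _)) (qPow_ne_zero _ _)
  obtain ⟨C, M, hC, hM, hb⟩ := exists_norm_qPochInf_div_le (norm_qPow_one_lt hτ) (qPow_ne_zero τ 1)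
    (qPow τ (1 - γ) * qPow τ (X j) / qPow τ (X i)) _ hne (h.zpow_mul_ne_one hij)
  refine GeomBounded.of_le hC hM (fun ν => (ν j - ν i).natAbs) (fun ν hν => ?_) fun ν _ => ?_
  · have h2 : ∑ k ∈ {i, j}, (ν k).toNat ≤ ∑ k, (ν k).toNat :=
      Finset.sum_le_sum_of_subset (Finset.subset_univ _)
    rw [Finset.sum_pair hij.ne] at h2
    have := hν i
    have := hν j
    omega
  · have e : ∀ a : ℂ, a * qPow τ (X j + ν j) / qPow τ (X i + ν i) =
        a * qPow τ (X j) / qPow τ (X i) * qPow τ 1 ^ (ν j - ν i) := by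
      intro a
      rw [qPow_add, qPow_add, qPow_intCast, qPow_intCast, zpow_sub₀ (qPow_ne_zero _ _),
        ← mul_assoc, mul_div_mul_comm]
    unfold pairFactor
    rw [e, e]
    exact hb _

lemma geomBounded_PhiReg (hτ : 0 < τ.im) (hx₁ : x₁ ≠ 0) (hx₂ : x₂ ≠ 0) (α : ℂ)
    (h : AvoidsPoles τ γ x₁ x₂ β₁ β₂ X) :
    GeomBounded (fun ν => PhiReg τ α γ x₁ x₂ β₁ β₂ (fun j => X j + ν j)) := by
  simp only [PhiReg_eq]
  refine GeomBounded.mul (GeomBounded.mul (GeomBounded.prod _ fun j _ => geomBounded_qPow_mul _ j)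
    (GeomBounded.prod _ fun j _ => ?_)) (GeomBounded.prod _ fun i _ => GeomBounded.prod _
      fun j hj => geomBounded_pairFactor hτ h (Finset.mem_Ioi.mp hj))
  have := (((geomBounded_inv_qPochInf hτ _ j (h.pow_mul_ne_one₁ hx₁ j)).mul
    (geomBounded_inv_qPochInf hτ _ j (h.pow_mul_ne_one₂ hx₂ j))).mul
    ((geomBounded_qPochInf (X := X) hτ (qPow τ 1 / x₁) j).mul
      (geomBounded_qPochInf (X := X) hτ (qPow τ 1 / x₂) j)))
  refine this.congr_cone fun ν _ => ?_
  unfold singleFactor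
  simp only [div_mul_eq_mul_div, one_div, mul_inv, mul_comm (qPow τ (X j + ν j))]

lemma geomBounded_matsuoNumTerm (hτ : 0 < τ.im) (y₁ y₂ b₁ : ℂ) (l : ℕ)
    (σ : Equiv.Perm (Fin n)) :
    GeomBounded (fun ν => matsuoNumTerm τ γ y₁ y₂ b₁ l
      ((fun j => qPow τ (X j + (ν j : ℤ))) ∘ σ)) := by
  unfold matsuoNumTerm qVand
  have ht : ∀ k, GeomBounded
      (fun ν : Fin n → ℤ => ((fun j => qPow τ (X j + (ν j : ℤ))) ∘ σ) k) :=
    fun k => geomBounded_qPow hτ (σ k)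
  refine GeomBounded.mul (GeomBounded.prod _ fun k _ => ?_) (GeomBounded.prod _ fun i _ =>
    GeomBounded.prod _ fun j _ => (ht i).sub ((GeomBounded.const _).mul (ht j)))
  split_ifs
  · simp only [div_eq_mul_inv]
    exact (GeomBounded.const 1).sub (((GeomBounded.const _).mul (ht k)).mul (GeomBounded.const _))
  · simp only [div_eq_mul_inv]
    exact (GeomBounded.const 1).sub ((ht k).mul (GeomBounded.const _))

end Growth

/-! ### Power series in `w = q ^ α`. -/

lemma summable_prod_pi {h : ℤ → ℝ} (h₀ : ∀ m, 0 ≤ h m) (hs : Summable h) (n : ℕ) :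
    Summable fun ν : Fin n → ℤ => ∏ j, h (ν j) := by
  induction n with
  | zero => exact Summable.of_finite
  | succ n ih =>
    have := hs.mul_of_nonneg ih h₀ fun ν => Finset.prod_nonneg fun j _ => h₀ _
    rw [← (Fin.consEquiv fun _ => ℤ).summable_iff]
    refine this.congr fun x => ?_
    simp [Fin.prod_univ_succ, Fin.consEquiv]

lemma summable_half_pow_cone (n : ℕ) :
    Summable fun ν : Fin n → ℤ =>
      if ∀ j, 0 ≤ ν j then (1 / 2 : ℝ) ^ (∑ j, (ν j).toNat) else 0 := by
  have hs : Summable fun m : ℤ => if 0 ≤ m then (1 / 2 : ℝ) ^ m.toNat else 0 := by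
    refine Summable.of_nat_of_neg (by simpa using summable_geometric_two) ?_
    refine summable_of_ne_finset_zero (s := {0}) fun k hk => if_neg ?_
    have : k ≠ 0 := by simpa using hk
    omega
  refine (summable_prod_pi (fun m => by positivity) hs n).congr fun ν => ?_
  by_cases hν : ∀ j, 0 ≤ ν j
  · simp only [hν, implies_true, if_true, Finset.prod_pow_eq_pow_sum]
  · rw [if_neg hν]
    push Not at hν
    obtain ⟨j, hj⟩ := hν
    exact Finset.prod_eq_zero (Finset.mem_univ j) (if_neg (not_le.mpr hj))

section PowerSeries

variable {n : ℕ} {f : (Fin n → ℤ) → ℂ}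

/-- If `M` is the growth rate, then `‖w‖ < 1 / (2 M)` suffices. The majorant does not depend on `w`,
so it serves both for summability and for dominated convergence as `w → 0`. -/
lemma eventually_norm_pow_mul_le (hf : GeomBounded f)
    (hs : ∀ ν, f ν ≠ 0 → ∀ j, 0 ≤ ν j) :
    ∃ C : ℝ, ∀ᶠ w : ℂ in nhds 0, ∀ ν : Fin n → ℤ, ‖w ^ (∑ j, (ν j).toNat) * f ν‖ ≤
      C * if ∀ j, 0 ≤ ν j then (1 / 2 : ℝ) ^ (∑ j, (ν j).toNat) else 0 := by
  obtain ⟨C, M, hC, hM, h⟩ := hf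
  refine ⟨C, ?_⟩
  have hM0 : 0 < M := by linarith
  filter_upwards [Metric.ball_mem_nhds (0 : ℂ) (by positivity : (0 : ℝ) < 1 / (2 * M))] with w hw ν
  have hw' : ‖w‖ * M ≤ 1 / 2 := by
    rw [mem_ball_zero_iff, lt_div_iff₀ (by positivity)] at hw
    linarith
  by_cases hν : ∀ j, 0 ≤ ν j
  · rw [if_pos hν, norm_mul, norm_pow]
    calc _ ≤ ‖w‖ ^ (∑ j, (ν j).toNat) * (C * M ^ (∑ j, (ν j).toNat)) := by gcongr; exact h ν hν
      _ = C * (‖w‖ * M) ^ (∑ j, (ν j).toNat) := by rw [mul_pow]; ring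
      _ ≤ _ := by gcongr
  · have : f ν = 0 := by
      by_contra hne
      exact hν (hs ν hne)
    rw [this, if_neg hν]
    simp

lemma eventually_summable_pow_mul (hf : GeomBounded f) (hs : ∀ ν, f ν ≠ 0 → ∀ j, 0 ≤ ν j) :
    ∀ᶠ w : ℂ in nhds 0, Summable fun ν : Fin n → ℤ => w ^ (∑ j, (ν j).toNat) * f ν := by
  obtain ⟨C, h⟩ := eventually_norm_pow_mul_le hf hs
  filter_upwards [h] with w hw
  exact Summable.of_norm_bounded ((summable_half_pow_cone n).mul_left C) hw

lemma tendsto_tsum_pow_mul (hf : GeomBounded f) (hs : ∀ ν, f ν ≠ 0 → ∀ j, 0 ≤ ν j) :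
    Filter.Tendsto (fun w : ℂ => ∑' ν : Fin n → ℤ, w ^ (∑ j, (ν j).toNat) * f ν) (nhds 0)
      (nhds (f 0)) := by
  obtain ⟨C, h⟩ := eventually_norm_pow_mul_le hf hs
  have key := tendsto_tsum_of_dominated_convergence ((summable_half_pow_cone n).mul_left C)
    (f := fun (w : ℂ) ν => w ^ (∑ j, (ν j).toNat) * f ν)
    (g := fun ν => (0 : ℂ) ^ (∑ j, (ν j).toNat) * f ν)
    (fun ν => ((continuous_id.pow _).mul continuous_const).tendsto 0) h
  have e : ∑' ν : Fin n → ℤ, (0 : ℂ) ^ (∑ j, (ν j).toNat) * f ν = f 0 := by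
    rw [tsum_eq_single 0]
    · simp
    · intro ν hν
      by_cases h0 : f ν = 0
      · rw [h0, mul_zero]
      · obtain ⟨j, hj⟩ := Function.ne_iff.mp hν
        have h1 := hs ν h0 j
        have h2 := toNat_le_sum ν j
        have h3 : ν j ≠ 0 := hj
        rw [zero_pow (by omega), zero_mul]
  rwa [e] at key

end PowerSeries

/-! ### Lattices through chains of ratio `q ^ γ`. -/

lemma qPow_sub_eq_one {τ a b : ℂ} (h : qPow τ a = qPow τ b) : qPow τ (a - b) = 1 := by
  rw [qPow_sub, h, div_self (qPow_ne_zero _ _)]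

lemma exists_qPow_eq {τ : ℂ} (hτ : 0 < τ.im) {x : ℂ} (hx : x ≠ 0) : ∃ a, qPow τ a = x := by
  have h : (2 * Real.pi * Complex.I * τ : ℂ) ≠ 0 := by
    have : τ ≠ 0 := fun e => by simp [e] at hτ
    simp [this, Real.pi_ne_zero]
  refine ⟨Complex.log x / (2 * Real.pi * Complex.I * τ), ?_⟩
  unfold qPow
  rw [mul_div_cancel₀ _ h, Complex.exp_log hx]

lemma qPow_natCast_succ_ne_one {τ : ℂ} (hτ : 0 < τ.im) (k : ℕ) : qPow τ ((k + 1 : ℕ) : ℂ) ≠ 1 := by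
  intro e
  have h := pow_lt_one₀ (norm_nonneg (qPow τ 1)) (norm_qPow_one_lt hτ) (Nat.succ_ne_zero k)
  rw [← norm_pow, ← qPow_natCast, e, norm_one] at h
  exact lt_irrefl _ h

/-- Logarithmic coordinates of `(x₁, q ^ γ x₁, …, q ^ ((r - 1) γ) x₁, x₂, q ^ γ x₂, …)`, where
`x_i = q ^ a_i`. -/
def chainPoint {n : ℕ} (γ a₁ a₂ : ℂ) (r : ℕ) (j : Fin n) : ℂ :=
  if j.val < r then a₁ + j.val * γ else a₂ + ((j.val : ℂ) - r) * γ

section Chain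

variable {n : ℕ} {τ γ a₁ a₂ β₁ β₂ : ℂ} {r : ℕ}

/-- Within one chain, equality would give `q ^ (k γ + m) = 1` with `k = j - i + d ≥ 1`; across the
chains it would give such a relation for `x₂ / x₁`. The case `d = 1` excludes poles of the pair
factors and `d = -1` their zeros. -/
lemma Generic.chainPoint_ne (hg : Generic n τ γ (qPow τ a₁) (qPow τ a₂) β₁ β₂)
    {i j : Fin n} (hij : i < j) (d m : ℤ) (hd : |d| ≤ 1)
    (h : (j.val < r ∨ r ≤ i.val) → 1 ≤ (j.val : ℤ) - i.val + d) :
    qPow τ (chainPoint γ a₁ a₂ r j + d * γ + m) ≠ qPow τ (chainPoint γ a₁ a₂ r i) := by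
  have hlt : i.val < j.val := hij
  have hj := j.isLt
  rw [abs_le] at hd
  intro e
  have same : (j.val < r ∨ r ≤ i.val) →
      qPow τ (((j.val : ℂ) - i.val + d) * γ + m) ≠ 1 := by
    intro hc
    have h1 := h hc
    have := hg.1 ((j.val : ℤ) - i.val + d).toNat m (by omega) (by omega)
    have hcast : ((((j.val : ℤ) - i.val + d).toNat : ℕ) : ℂ) = (j.val : ℂ) - i.val + d := by
      rw [← Int.cast_natCast, Int.toNat_of_nonneg (by omega)]
      push_cast
      ring
    rwa [hcast] at this
  unfold chainPoint at e
  by_cases hjr : j.val < r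
  · rw [if_pos hjr, if_pos (by omega)] at e
    refine same (Or.inl hjr) ?_
    refine Eq.trans ?_ (qPow_sub_eq_one e)
    congr 1
    ring
  · by_cases hir : i.val < r
    · rw [if_neg hjr, if_pos hir] at e
      refine (hg.2 ((j.val : ℤ) - r + d - i.val) m (by rw [abs_le]; constructor <;> omega)).1 ?_
      rw [← qPow_add]
      have e' : a₂ + ((((j.val : ℤ) - r + d - i.val : ℤ) : ℂ) * γ + m) =
          a₂ + ((j.val : ℂ) - r) * γ + d * γ + m - i.val * γ := by
        push_cast
        ring
      rw [e', qPow_sub, e, ← qPow_sub, add_sub_cancel_right]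
    · rw [if_neg hjr, if_neg hir] at e
      refine same (Or.inr (not_lt.mp hir)) ?_
      refine Eq.trans ?_ (qPow_sub_eq_one e)
      congr 1
      ring

lemma Generic.avoidsPoles_chainPoint (hg : Generic n τ γ (qPow τ a₁) (qPow τ a₂) β₁ β₂) :
    AvoidsPoles τ γ (qPow τ a₁) (qPow τ a₂) β₁ β₂ (chainPoint (n := n) γ a₁ a₂ r) := by
  refine ⟨fun j m => ?_, fun i j m hij => ?_⟩
  · have hj := j.isLt
    unfold chainPoint
    by_cases hjr : j.val < r
    · simp only [if_pos hjr]
      obtain ⟨_, h2, _, _, h5⟩ := hg.2 (j.val : ℤ) m (by rw [abs_le]; constructor <;> omega)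
      refine ⟨fun e => h2 ?_, fun e => h5 ?_⟩
      · refine Eq.trans ?_ (qPow_sub_eq_one e)
        congr 1
        push_cast
        ring
      · rw [← e, ← qPow_add]
        congr 1
        push_cast
        ring
    · simp only [if_neg hjr]
      obtain ⟨_, _, h3, h4, _⟩ := hg.2 ((j.val : ℤ) - r) m (by rw [abs_le]; constructor <;> omega)
      refine ⟨fun e => h4 ?_, fun e => h3 ?_⟩
      · rw [← e, ← qPow_add]
        congr 1
        push_cast
        ring
      · refine Eq.trans ?_ (qPow_sub_eq_one e)
        congr 1
        push_cast
        ring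
  · have hlt : i.val < j.val := hij
    have := hg.chainPoint_ne (r := r) hij 1 m (by simp) (fun _ => by omega)
    simpa using this

lemma AvoidsPoles.shift {x₁ x₂ : ℂ} {X : Fin n → ℂ} (h : AvoidsPoles τ γ x₁ x₂ β₁ β₂ X) :
    AvoidsPoles τ γ x₁ (qPow τ 1 * x₂) β₁ β₂ X := by
  refine ⟨fun j m => ⟨(h.1 j m).1, fun e => (h.1 j (m - 1)).2 ?_⟩, h.2⟩
  have : X j + β₂ + ((m - 1 : ℤ) : ℂ) = X j + β₂ + m - 1 := by
    push_cast
    ring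
  rw [this, qPow_sub, e, mul_div_cancel_left₀ _ (qPow_ne_zero _ _)]

lemma one_le_of_qPochInf_qPow_ne_zero {A : ℂ} {m : ℤ} (hA : A = m)
    (h : qPochInf (qPow τ A) (qPow τ 1) ≠ 0) : 1 ≤ m := by
  rw [hA, qPow_intCast] at h
  exact one_le_of_qPochInf_zpow_ne_zero (qPow_ne_zero _ _) h

/-- On the lattice through `chainPoint` the function `Φ` is supported on nonnegative exponents. -/
lemma nonneg_of_PhiReg_ne_zero (α : ℂ) {x₂ : ℂ} (e : ℕ)
    (hx₂ : x₂ = qPow τ (a₂ + e)) (ν : Fin n → ℤ)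
    (h : PhiReg τ α γ (qPow τ a₁) x₂ β₁ β₂ (fun j => chainPoint γ a₁ a₂ r j + ν j) ≠ 0) :
    ∀ j, 0 ≤ ν j := by
  rw [PhiReg_eq] at h
  have hs := Finset.prod_ne_zero_iff.mp (right_ne_zero_of_mul (left_ne_zero_of_mul h))
  have hp := Finset.prod_ne_zero_iff.mp (right_ne_zero_of_mul h)
  -- For neighbours in a chain the numerator of the pair factor is `(q ^ (1 + ν j - ν i))_∞`, so
  -- exponents are nondecreasing along each chain.
  have step : ∀ i j : Fin n, j.val = i.val + 1 → j.val ≠ r → 0 ≤ ν i → 0 ≤ ν j := by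
    intro i j hij hjr hi
    have h1 := Finset.prod_ne_zero_iff.mp (hp i (Finset.mem_univ i)) j
      (Finset.mem_Ioi.mpr (Fin.lt_def.mpr (by omega)))
    have h2 := (div_ne_zero_iff.mp h1).1
    rw [← qPow_add, ← qPow_sub] at h2
    have := one_le_of_qPochInf_qPow_ne_zero (m := 1 + ν j - ν i) (by
      have hc : (j.val : ℂ) = i.val + 1 := by exact_mod_cast hij
      unfold chainPoint
      by_cases hlt : j.val < r
      · rw [if_pos hlt, if_pos (by omega), hc]
        push_cast
        ring
      · rw [if_neg hlt, if_neg (by omega), hc]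
        push_cast
        ring) h2
    omega
  -- The heads of the chains are controlled by the factors `(q t / x₁)_∞` and `(q t / x₂)_∞`; at the
  -- second head the argument is `q ^ (1 + ν - e)`, so the exponent there is even at least `e`.
  have main : ∀ (k : ℕ) (hk : k < n), 0 ≤ ν ⟨k, hk⟩ := by
    intro k
    induction k with
    | zero =>
      intro hk
      have h1 := right_ne_zero_of_mul (hs ⟨0, hk⟩ (Finset.mem_univ _))
      by_cases hr0 : 0 < r
      · have h2 := left_ne_zero_of_mul h1
        rw [← qPow_add, ← qPow_sub] at h2
        have := one_le_of_qPochInf_qPow_ne_zero (m := 1 + ν ⟨0, hk⟩) (by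
          simp only [chainPoint, if_pos hr0]
          push_cast
          ring) h2
        omega
      · have h2 := right_ne_zero_of_mul h1
        rw [hx₂, ← qPow_add, ← qPow_sub] at h2
        have hr0' : r = 0 := by omega
        have := one_le_of_qPochInf_qPow_ne_zero (m := 1 + ν ⟨0, hk⟩ - e) (by
          simp only [chainPoint, hr0']
          push_cast
          ring) h2
        omega
    | succ k ih =>
      intro hk
      by_cases hkr : k + 1 = r
      · have h2 := right_ne_zero_of_mul (right_ne_zero_of_mul (hs ⟨k + 1, hk⟩ (Finset.mem_univ _)))
        rw [hx₂, ← qPow_add, ← qPow_sub] at h2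
        have := one_le_of_qPochInf_qPow_ne_zero (m := 1 + ν ⟨k + 1, hk⟩ - e) (by
          simp only [chainPoint, ← hkr, lt_irrefl, if_false]
          push_cast
          ring) h2
        omega
      · exact step ⟨k, by omega⟩ ⟨k + 1, hk⟩ rfl hkr (ih (by omega))
  exact fun j => main j.val j.isLt

lemma Generic.PhiReg_chainPoint_ne_zero (hτ : 0 < τ.im)
    (hg : Generic n τ γ (qPow τ a₁) (qPow τ a₂) β₁ β₂) (α : ℂ) :
    PhiReg τ α γ (qPow τ a₁) (qPow τ a₂) β₁ β₂ (chainPoint (n := n) γ a₁ a₂ r) ≠ 0 := by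
  have hq := norm_qPow_one_lt hτ
  have hX := hg.avoidsPoles_chainPoint (r := r)
  have hself : ∀ (d k : ℕ), d < n → qPow τ (d * γ + ((k + 1 : ℕ) : ℂ)) ≠ 1 := by
    intro d k hd
    rcases Nat.eq_zero_or_pos d with rfl | hd0
    · simpa using qPow_natCast_succ_ne_one hτ k
    · simpa using hg.1 d (k + 1 : ℕ) hd0 hd.le
  rw [PhiReg_eq]
  refine mul_ne_zero (mul_ne_zero (Finset.prod_ne_zero_iff.mpr fun j _ => qPow_ne_zero _ _)
    (Finset.prod_ne_zero_iff.mpr fun j _ => ?_))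
    (Finset.prod_ne_zero_iff.mpr fun i _ => Finset.prod_ne_zero_iff.mpr fun j hj => ?_)
  · have hj := j.isLt
    unfold singleFactor
    refine mul_ne_zero (one_div_ne_zero (mul_ne_zero ?_ ?_)) (mul_ne_zero ?_ ?_) <;>
      refine qPochInf_ne_zero hq fun k e => ?_
    · refine hX.pow_mul_ne_one₁ (qPow_ne_zero _ _) j k (Eq.trans ?_ e)
      ring
    · refine hX.pow_mul_ne_one₂ (qPow_ne_zero _ _) j k (Eq.trans ?_ e)
      ring
    · rw [← qPow_natCast, ← qPow_add, ← qPow_sub, ← qPow_add] at e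
      unfold chainPoint at e
      by_cases hjr : j.val < r
      · refine hself j.val k hj ?_
        rw [← e, if_pos hjr]
        congr 1
        push_cast
        ring
      · refine (hg.2 ((j.val : ℤ) - r) (k + 1 : ℕ) (by rw [abs_le]; constructor <;> omega)).1 ?_
        rw [← one_mul (qPow τ a₁), ← e, if_neg hjr, ← qPow_add, ← qPow_add]
        congr 1
        push_cast
        ring
    · rw [← qPow_natCast, ← qPow_add, ← qPow_sub, ← qPow_add] at e
      unfold chainPoint at e
      by_cases hjr : j.val < r
      · refine (hg.2 (-(j.val : ℤ)) (-(k + 1 : ℕ)) (by rw [abs_le]; constructor <;> omega)).1 ?_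
        rw [← mul_one (qPow τ a₂ * _), ← e, if_pos hjr, ← qPow_add, ← qPow_add]
        congr 1
        push_cast
        ring
      · refine hself (j.val - r) k (by omega) ?_
        rw [← e, if_neg hjr, Nat.cast_sub (by omega)]
        congr 1
        push_cast
        ring
  · have hij : i < j := Finset.mem_Ioi.mp hj
    have hlt : i.val < j.val := hij
    unfold pairFactor
    refine div_ne_zero ?_ ?_ <;> refine qPochInf_ne_zero hq fun k e => ?_
    · rw [← qPow_natCast, ← qPow_add, ← qPow_sub, ← qPow_add] at e
      by_cases hc : j.val = i.val + 1 ∧ (j.val < r ∨ r ≤ i.val)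
      · refine qPow_natCast_succ_ne_one hτ k ?_
        rw [← e]
        have hcast : (j.val : ℂ) = i.val + 1 := by exact_mod_cast hc.1
        congr 1
        unfold chainPoint
        by_cases hjr : j.val < r
        · rw [if_pos hjr, if_pos (by omega), hcast]
          push_cast
          ring
        · rw [if_neg hjr, if_neg (by omega), hcast]
          push_cast
          ring
      · refine hg.chainPoint_ne (r := r) hij (-1) (k + 1 : ℕ) (by simp) (fun h => ?_) ?_
        · have : j.val ≠ i.val + 1 := fun h' => hc ⟨h', h⟩
          omega
        · rw [← one_mul (qPow τ (chainPoint γ a₁ a₂ r i)), ← e, ← qPow_add]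
          congr 1
          push_cast
          ring
    · exact hX.zpow_mul_ne_one hij k (by exact_mod_cast e)

/-- Reversal of the first `r` and of the last `n - r` positions. -/
def reverseBlocks (n r : ℕ) (hr : r ≤ n) : Equiv.Perm (Fin n) :=
  Function.Involutive.toPerm
    (fun j => if h : j.val < r then ⟨r - 1 - j.val, by omega⟩ else ⟨n + r - 1 - j.val, by omega⟩)
    (fun j => by
      ext
      by_cases h : j.val < r
      · have : r - 1 - j.val < r := by omega
        simp [h, this]
        omega
      · have : ¬ n + r - 1 - j.val < r := by have := j.isLt; omega
        simp [h, this]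
        omega)

lemma reverseBlocks_symm_val (hr : r ≤ n) (j : Fin n) :
    ((reverseBlocks n r hr).symm j).val =
      if j.val < r then r - 1 - j.val else n + r - 1 - j.val := by
  change (if h : j.val < r then (⟨r - 1 - j.val, _⟩ : Fin n) else ⟨n + r - 1 - j.val, _⟩).val = _
  split_ifs <;> rfl

/-- Positions strictly decrease along each chain and the first chain starts below `l`, so it
occupies `r` distinct positions below `l`. If `l = r` it fills them all in decreasing order, which
leaves the second chain the remaining positions, again in decreasing order. -/
lemma le_and_eq_reverseBlocks (hr : r ≤ n) {l : ℕ} (σ : Equiv.Perm (Fin n))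
    (h₁ : ∀ i j : Fin n, j.val = i.val + 1 → j.val ≠ r → σ.symm j < σ.symm i)
    (h₂ : ∀ i : Fin n, i.val = 0 → 0 < r → (σ.symm i).val < l) :
    r ≤ l ∧ (l = r → σ = reverseBlocks n r hr) := by
  have ha : ∀ (k : ℕ) (hk : k < n), k < r → (σ.symm ⟨k, hk⟩).val + k < l := by
    intro k
    induction k with
    | zero => exact fun hk hkr => h₂ ⟨0, hk⟩ rfl hkr
    | succ k ih =>
      intro hk hkr
      have := ih (by omega) (by omega)
      have h' : (σ.symm ⟨k + 1, hk⟩).val < (σ.symm ⟨k, by omega⟩).val :=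
        h₁ ⟨k, by omega⟩ ⟨k + 1, hk⟩ rfl hkr.ne
      omega
  refine ⟨?_, fun hl => ?_⟩
  · by_contra! hlr
    have := ha (r - 1) (by omega) (by omega)
    omega
  · subst hl
    have hb : ∀ (d k : ℕ) (hk : k < n), k + d + 1 = l → d ≤ (σ.symm ⟨k, hk⟩).val := by
      intro d
      induction d with
      | zero => exact fun _ _ _ => Nat.zero_le _
      | succ d ih =>
        intro k hk hkd
        have := ih (k + 1) (by omega) (by omega)
        have h' : (σ.symm ⟨k + 1, by omega⟩).val < (σ.symm ⟨k, hk⟩).val :=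
          h₁ ⟨k, hk⟩ ⟨k + 1, by omega⟩ rfl (by simp only [ne_eq]; omega)
        omega
    have hfirst : ∀ (k : ℕ) (hk : k < n), k < l → (σ.symm ⟨k, hk⟩).val = l - 1 - k := by
      intro k hk hkl
      have := ha k hk hkl
      have := hb (l - 1 - k) k hk (by omega)
      omega
    have hge : ∀ (k : ℕ) (hk : k < n), l ≤ k → l ≤ (σ.symm ⟨k, hk⟩).val := by
      intro k hk hkl
      by_contra! hlt
      have := hfirst (l - 1 - (σ.symm ⟨k, hk⟩).val) (by omega) (by omega)
      have heq : σ.symm ⟨l - 1 - (σ.symm ⟨k, hk⟩).val, by omega⟩ = σ.symm ⟨k, hk⟩ := by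
        ext
        omega
      have := congrArg Fin.val (σ.symm.injective heq)
      simp only at this
      omega
    have hc : ∀ (d : ℕ) (hk : l + d < n), (σ.symm ⟨l + d, hk⟩).val + d + 1 ≤ n := by
      intro d
      induction d with
      | zero => exact fun hk => by have := (σ.symm ⟨l + 0, hk⟩).isLt; omega
      | succ d ih =>
        intro hk
        have := ih (by omega)
        have h' : (σ.symm ⟨l + (d + 1), hk⟩).val < (σ.symm ⟨l + d, by omega⟩).val :=
          h₁ ⟨l + d, by omega⟩ ⟨l + (d + 1), hk⟩ rfl (by simp only [ne_eq]; omega)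
        omega
    have hd : ∀ (d k : ℕ) (hk : k < n), k + d + 1 = n → l ≤ k → l + d ≤ (σ.symm ⟨k, hk⟩).val := by
      intro d
      induction d with
      | zero => exact fun k hk _ hlk => hge k hk hlk
      | succ d ih =>
        intro k hk hkd hlk
        have := ih (k + 1) (by omega) (by omega) (by omega)
        have h' : (σ.symm ⟨k + 1, by omega⟩).val < (σ.symm ⟨k, hk⟩).val :=
          h₁ ⟨k, hk⟩ ⟨k + 1, by omega⟩ rfl (by simp only [ne_eq]; omega)
        omega
    have hsymm : σ.symm = (reverseBlocks n l hr).symm := by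
      ext j
      rw [reverseBlocks_symm_val]
      have hj := j.isLt
      split_ifs with hjl
      · exact hfirst j.val hj hjl
      · have h3 := hd (n - 1 - j.val) j.val hj (by omega) (by omega)
        have h4 := hc (j.val - l) (by omega)
        have h5 : l + (j.val - l) = j.val := by omega
        simp only [h5, Fin.eta] at h3 h4
        omega
    rw [← Equiv.symm_symm σ, hsymm, Equiv.symm_symm]

lemma prod_comp_symm_ne_zero {f : Fin n → Fin n → ℂ} (σ : Equiv.Perm (Fin n)) :
    (∏ k, f k (σ k) ≠ 0) ↔ ∀ j, f (σ.symm j) j ≠ 0 := by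
  rw [Finset.prod_ne_zero_iff]
  refine ⟨fun h j => by simpa using h (σ.symm j) (Finset.mem_univ _), fun h k _ => ?_⟩
  simpa using h (σ k)

lemma qVand_comp_ne_zero_iff (t : Fin n → ℂ) (σ : Equiv.Perm (Fin n)) :
    qVand τ γ (t ∘ σ) ≠ 0 ↔
      ∀ i j, σ.symm i < σ.symm j → t i - qPow τ (-γ) * t j ≠ 0 := by
  unfold qVand
  simp only [Finset.prod_ne_zero_iff, Finset.mem_univ, true_imp_iff, Finset.mem_Ioi,
    Function.comp_apply]
  refine ⟨fun h i j hij => by simpa using h _ _ hij, fun h a b hab => ?_⟩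
  exact h (σ a) (σ b) (by simpa using hab)

/-- Since `t_{i+1} = q ^ γ t_i` along a chain, the factor `t_i - Q t_{i+1}` is zero unless `t_{i+1}`
is placed before `t_i`. Since the first chain starts at `x₁`, its head must avoid the factors `1 - t
/ x₁`, hence sit among the first `l` positions. -/
lemma le_and_eq_of_matsuoNumTerm_ne_zero (hr : r ≤ n) {y₁ b₁ : ℂ} {l : ℕ}
    (σ : Equiv.Perm (Fin n))
    (h : matsuoNumTerm τ γ y₁ (qPow τ a₁) b₁ l
      ((fun j => qPow τ (chainPoint (n := n) γ a₁ a₂ r j)) ∘ σ) ≠ 0) :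
    r ≤ l ∧ (l = r → σ = reverseBlocks n r hr) := by
  unfold matsuoNumTerm at h
  have hs := (prod_comp_symm_ne_zero (f := fun k j => if k.val < l then
    1 - qPow τ b₁ * qPow τ (chainPoint γ a₁ a₂ r j) / y₁ else
    1 - qPow τ (chainPoint γ a₁ a₂ r j) / qPow τ a₁) σ).mp (left_ne_zero_of_mul h)
  have hv := (qVand_comp_ne_zero_iff _ σ).mp (right_ne_zero_of_mul h)
  refine le_and_eq_reverseBlocks hr σ (fun i j hij hjr => ?_) (fun i hi hr0 => ?_)
  · have hne : σ.symm i ≠ σ.symm j := fun e => by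
      have := congrArg Fin.val (σ.symm.injective e)
      omega
    refine lt_of_le_of_ne (not_lt.mp fun hlt => hv i j hlt ?_) hne.symm
    have hc : (j.val : ℂ) = i.val + 1 := by exact_mod_cast hij
    rw [← qPow_add, sub_eq_zero]
    congr 1
    unfold chainPoint
    by_cases hlt' : j.val < r
    · rw [if_pos hlt', if_pos (by omega), hc]
      ring
    · rw [if_neg hlt', if_neg (by omega), hc]
      ring
  · by_contra hl
    refine hs i ?_
    simp only [if_neg hl, chainPoint, hi, if_pos hr0]
    simp [div_self (qPow_ne_zero τ a₁)]

lemma Generic.matsuoNumTerm_reverseBlocks_ne_zero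
    (hg : Generic n τ γ (qPow τ a₁) (qPow τ a₂) β₁ β₂) (hr : r ≤ n) :
    matsuoNumTerm τ γ (qPow τ a₂) (qPow τ a₁) β₂ r
      ((fun j => qPow τ (chainPoint (n := n) γ a₁ a₂ r j)) ∘ reverseBlocks n r hr) ≠ 0 := by
  unfold matsuoNumTerm
  refine mul_ne_zero ((prod_comp_symm_ne_zero (f := fun k j => if k.val < r then
    1 - qPow τ β₂ * qPow τ (chainPoint γ a₁ a₂ r j) / qPow τ a₂ else
    1 - qPow τ (chainPoint γ a₁ a₂ r j) / qPow τ a₁) _).mpr fun j => ?_)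
    ((qVand_comp_ne_zero_iff _ _).mpr fun i j hij e => ?_)
  · have hj := j.isLt
    rw [reverseBlocks_symm_val]
    by_cases hjr : j.val < r
    · simp only [if_pos hjr, if_pos (show r - 1 - j.val < r by omega), chainPoint]
      refine one_sub_div_ne_zero (qPow_ne_zero _ _) fun e => ?_
      refine (hg.2 j.val 0 (by rw [abs_le]; constructor <;> omega)).2.2.2.2 ?_
      rw [← e, ← qPow_add, ← qPow_add]
      congr 1
      push_cast
      ring
    · simp only [if_neg hjr, if_neg (show ¬ n + r - 1 - j.val < r by omega), chainPoint]
      refine one_sub_div_ne_zero (qPow_ne_zero _ _) fun e => ?_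
      refine (hg.2 (j.val - r) 0 (by rw [abs_le]; constructor <;> omega)).1 ?_
      rw [← e, ← qPow_add]
      congr 1
      push_cast
      ring
  · rw [Fin.lt_def, reverseBlocks_symm_val, reverseBlocks_symm_val] at hij
    have hi := i.isLt
    have hj := j.isLt
    rw [← qPow_add, sub_eq_zero] at e
    have same : j.val < i.val → qPow τ (((i.val : ℂ) - j.val + 1) * γ) ≠ 1 := by
      intro hji
      have := hg.1 (i.val - j.val + 1) 0 (by omega) (by omega)
      push_cast [hji.le] at this
      rwa [add_zero] at this
    unfold chainPoint at e
    by_cases hir : i.val < r <;> by_cases hjr : j.val < r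
    · rw [if_pos hir, if_pos hjr] at hij e
      refine same (by omega) ?_
      refine Eq.trans ?_ (qPow_sub_eq_one e)
      congr 1
      ring
    · rw [if_pos hir, if_neg hjr] at e
      refine (hg.2 (j.val - r - 1 - i.val) 0 (by rw [abs_le]; constructor <;> omega)).1 ?_
      have e' : a₂ + ((((j.val : ℤ) - r - 1 - i.val : ℤ) : ℂ) * γ + ((0 : ℤ) : ℂ)) =
          -γ + (a₂ + ((j.val : ℂ) - r) * γ) - i.val * γ := by
        push_cast
        ring
      rw [← qPow_add, e', qPow_sub, ← e, ← qPow_sub, add_sub_cancel_right]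
    · rw [if_neg hir, if_pos hjr] at hij
      omega
    · rw [if_neg hir, if_neg hjr] at hij e
      refine same (by omega) ?_
      refine Eq.trans ?_ (qPow_sub_eq_one e)
      congr 1
      ring

lemma matsuoNum_chainPoint_eq_zero (hr : r ≤ n) {s : ℕ} (hs : s ≤ n) (hrs : n < r + s)
    {y₁ b₁ : ℂ} :
    matsuoNum τ γ y₁ (qPow τ a₁) b₁ s (fun j => qPow τ (chainPoint (n := n) γ a₁ a₂ r j)) = 0 := by
  unfold matsuoNum altSum
  refine Finset.sum_eq_zero fun σ _ => mul_eq_zero_of_right _ ?_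
  by_contra h
  have := (le_and_eq_of_matsuoNumTerm_ne_zero hr σ h).1
  omega

/-- A single permutation, `reverseBlocks`, survives in the alternating sum, so no cancellation can
occur. -/
lemma Generic.matsuoNum_chainPoint_ne_zero
    (hg : Generic n τ γ (qPow τ a₁) (qPow τ a₂) β₁ β₂) {s : ℕ} (hrs : r + s = n) :
    matsuoNum τ γ (qPow τ a₂) (qPow τ a₁) β₂ s
      (fun j => qPow τ (chainPoint (n := n) γ a₁ a₂ r j)) ≠ 0 := by
  have hr : r ≤ n := by omega
  have hl : n - s = r := by omega
  unfold matsuoNum altSum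
  rw [hl, Finset.sum_eq_single (reverseBlocks n r hr)]
  · exact mul_ne_zero (Int.cast_ne_zero.mpr (Units.ne_zero _))
      (hg.matsuoNumTerm_reverseBlocks_ne_zero hr)
  · intro σ _ hσ
    refine mul_eq_zero_of_right _ ?_
    by_contra h
    exact hσ ((le_and_eq_of_matsuoNumTerm_ne_zero hr σ h).2 rfl)
  · simp

end Chain

/-! ### Invertibility of the matrix of Jackson integrals for small `q ^ α`. -/

section Uniqueness

variable {n : ℕ} {τ γ a₁ a₂ β₁ β₂ : ℂ}

/-- The parameter `α` enters only through `q ^ (α ∑ X_j)`. On the support the lattice exponents are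
natural numbers, so their part is a power of `q ^ α`. -/
lemma PhiReg_chainPoint_add (r : ℕ) (α : ℂ) {x₂ : ℂ} (e : ℕ) (hx₂ : x₂ = qPow τ (a₂ + e))
    (ν : Fin n → ℤ) :
    PhiReg τ α γ (qPow τ a₁) x₂ β₁ β₂ (fun j => chainPoint γ a₁ a₂ r j + ν j) =
      qPow τ (α * ∑ j : Fin n, chainPoint γ a₁ a₂ r j) * (qPow τ α ^ (∑ j, (ν j).toNat) *
        PhiReg τ 0 γ (qPow τ a₁) x₂ β₁ β₂ (fun j => chainPoint γ a₁ a₂ r j + ν j)) := by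
  have key : PhiReg τ α γ (qPow τ a₁) x₂ β₁ β₂ (fun j => chainPoint γ a₁ a₂ r j + ν j) =
      qPow τ (α * ∑ j : Fin n, (chainPoint γ a₁ a₂ r j + ν j)) *
        PhiReg τ 0 γ (qPow τ a₁) x₂ β₁ β₂ (fun j => chainPoint γ a₁ a₂ r j + ν j) := by
    have e₁ : (∏ j : Fin n, qPow τ ((α - n + (j.val + 1) - 2 * j.val * γ) *
        (chainPoint γ a₁ a₂ r j + ν j))) =
        qPow τ (α * ∑ j : Fin n, (chainPoint γ a₁ a₂ r j + ν j)) *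
          ∏ j : Fin n, qPow τ ((0 - n + (j.val + 1) - 2 * j.val * γ) *
            (chainPoint γ a₁ a₂ r j + ν j)) := by
      rw [Finset.mul_sum, qPow_sum, ← Finset.prod_mul_distrib]
      refine Finset.prod_congr rfl fun j _ => ?_
      rw [← qPow_add]
      congr 1
      ring
    rw [PhiReg_eq, PhiReg_eq, e₁]
    ring
  by_cases h : PhiReg τ 0 γ (qPow τ a₁) x₂ β₁ β₂ (fun j => chainPoint γ a₁ a₂ r j + ν j) = 0
  · rw [key, h]
    simp
  · have hν := nonneg_of_PhiReg_ne_zero 0 e hx₂ ν h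
    rw [key, Finset.sum_add_distrib, mul_add, qPow_add, mul_assoc]
    congr 2
    rw [← qPow_nat_mul, mul_comm α]
    congr 2
    rw [Nat.cast_sum]
    refine Finset.sum_congr rfl fun j _ => ?_
    conv_lhs => rw [← Int.toNat_of_nonneg (hν j)]
    exact Int.cast_natCast _

lemma eventually_converges_chainPoint (hτ : 0 < τ.im) (r : ℕ) {x₂ : ℂ} (e : ℕ)
    (hx₂ : x₂ = qPow τ (a₂ + e))
    (hX : AvoidsPoles τ γ (qPow τ a₁) x₂ β₁ β₂ (chainPoint (n := n) γ a₁ a₂ r)) :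
    ∀ᶠ w : ℂ in nhds 0, ∀ α, qPow τ α = w →
      Converges τ α γ (qPow τ a₁) x₂ β₁ β₂ (chainPoint (n := n) γ a₁ a₂ r) := by
  have hx₂0 : x₂ ≠ 0 := hx₂ ▸ qPow_ne_zero _ _
  have h : ∀ (s : Fin (n + 1)) (σ : Equiv.Perm (Fin n)), ∀ᶠ w : ℂ in nhds 0,
      Summable fun ν : Fin n → ℤ => w ^ (∑ j, (ν j).toNat) *
        (PhiReg τ 0 γ (qPow τ a₁) x₂ β₁ β₂ (fun j => chainPoint γ a₁ a₂ r j + ν j) *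
          matsuoNumTerm τ γ x₂ (qPow τ a₁) β₂ (n - s.val)
            ((fun j => qPow τ (chainPoint γ a₁ a₂ r j + ν j)) ∘ σ)) := fun s σ =>
    eventually_summable_pow_mul ((geomBounded_PhiReg hτ (qPow_ne_zero _ _) hx₂0 0 hX).mul
      (geomBounded_matsuoNumTerm hτ _ _ _ _ σ))
      fun ν hν => nonneg_of_PhiReg_ne_zero 0 e hx₂ ν (left_ne_zero_of_mul hν)
  filter_upwards [Filter.eventually_all.mpr fun s => Filter.eventually_all.mpr (h s)]
    with w hw α hα s σ
  subst hα
  refine ((hw s σ).mul_left (qPow τ (α * ∑ j : Fin n, chainPoint γ a₁ a₂ r j))).congr fun ν => ?_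
  rw [PhiReg_chainPoint_add r α e hx₂ ν]
  ring

/-- The coefficients of the expansion of `φ̃_s` on the lattice through `chainPoint` in powers of
`q ^ α`. -/
def chainCoeff (n : ℕ) (τ γ a₁ a₂ β₁ β₂ : ℂ) (r s : ℕ) (ν : Fin n → ℤ) : ℂ :=
  PhiReg τ 0 γ (qPow τ a₁) (qPow τ a₂) β₁ β₂ (fun j => chainPoint γ a₁ a₂ r j + ν j) *
    matsuoNum τ γ (qPow τ a₂) (qPow τ a₁) β₂ s
      (fun j => qPow τ (chainPoint γ a₁ a₂ r j + ν j))

lemma phiTilde_chainPoint (r s : ℕ) (α : ℂ) :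
    phiTilde τ α γ (qPow τ a₁) (qPow τ a₂) β₁ β₂ s (chainPoint (n := n) γ a₁ a₂ r) =
      (1 - qPow τ 1) ^ n * qPow τ (α * ∑ j : Fin n, chainPoint γ a₁ a₂ r j) *
        ∑' ν : Fin n → ℤ, qPow τ α ^ (∑ j, (ν j).toNat) *
          chainCoeff n τ γ a₁ a₂ β₁ β₂ r s ν := by
  unfold phiTilde jackson chainCoeff
  rw [mul_assoc, ← tsum_mul_left (a := qPow τ (α * _))]
  congr 1
  refine tsum_congr fun ν => ?_
  beta_reduce
  rw [PhiReg_chainPoint_add r α 0 (by simp) ν]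
  ring

lemma geomBounded_chainCoeff (hτ : 0 < τ.im)
    (hg : Generic n τ γ (qPow τ a₁) (qPow τ a₂) β₁ β₂) (r s : ℕ) :
    GeomBounded (chainCoeff n τ γ a₁ a₂ β₁ β₂ r s) :=
  (geomBounded_PhiReg hτ (qPow_ne_zero _ _) (qPow_ne_zero _ _) 0
    hg.avoidsPoles_chainPoint).mul (GeomBounded.sum _ fun σ _ =>
      (GeomBounded.const _).mul (geomBounded_matsuoNumTerm hτ _ _ _ _ σ))

/-- The entry `(r, s)` vanishes when `r + s > n` and is nonzero when `r + s = n`. -/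
lemma det_chainCoeff_zero_ne_zero (hτ : 0 < τ.im)
    (hg : Generic n τ γ (qPow τ a₁) (qPow τ a₂) β₁ β₂) :
    (Matrix.of fun r s : Fin (n + 1) =>
      chainCoeff n τ γ a₁ a₂ β₁ β₂ r.val s.val 0).det ≠ 0 := by
  set A := Matrix.of fun r s : Fin (n + 1) => chainCoeff n τ γ a₁ a₂ β₁ β₂ r.val s.val 0 with hA
  have hle : ∀ i : Fin (n + 1), i.val ≤ n := fun i => Nat.lt_succ_iff.mp i.isLt
  have htri : (A.submatrix id Fin.revPerm).BlockTriangular id := by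
    intro i j hij
    have hlt : j.val < i.val := hij
    have hi := hle i
    have hrev : (Fin.rev j).val = n - j.val := by rw [Fin.val_rev]; omega
    simp only [hA, Matrix.submatrix_apply, id_eq, Fin.revPerm_apply, Matrix.of_apply, chainCoeff]
    simp only [Pi.zero_apply, Int.cast_zero, add_zero]
    rw [matsuoNum_chainPoint_eq_zero hi (by omega) (by omega), mul_zero]
  have hdet : (A.submatrix id Fin.revPerm).det ≠ 0 := by
    rw [Matrix.det_of_isUpperTriangular htri]
    refine Finset.prod_ne_zero_iff.mpr fun i _ => ?_
    have hi := hle i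
    have hrev : (Fin.rev i).val = n - i.val := by rw [Fin.val_rev]; omega
    simp only [hA, Matrix.submatrix_apply, id_eq, Fin.revPerm_apply, Matrix.of_apply, chainCoeff]
    simp only [Pi.zero_apply, Int.cast_zero, add_zero]
    exact mul_ne_zero (hg.PhiReg_chainPoint_ne_zero hτ 0)
      (hg.matsuoNum_chainPoint_ne_zero (by omega))
  rw [Matrix.det_permute'] at hdet
  exact right_ne_zero_of_mul hdet

lemma eventually_det_ne_zero (hτ : 0 < τ.im)
    (hg : Generic n τ γ (qPow τ a₁) (qPow τ a₂) β₁ β₂) :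
    ∀ᶠ w : ℂ in nhds 0, (Matrix.of fun r s : Fin (n + 1) =>
      ∑' ν : Fin n → ℤ, w ^ (∑ j, (ν j).toNat) *
        chainCoeff n τ γ a₁ a₂ β₁ β₂ r.val s.val ν).det ≠ 0 := by
  have hlim : Filter.Tendsto (fun w : ℂ => Matrix.of fun r s : Fin (n + 1) =>
      ∑' ν : Fin n → ℤ, w ^ (∑ j, (ν j).toNat) *
        chainCoeff n τ γ a₁ a₂ β₁ β₂ r.val s.val ν) (nhds 0)
      (nhds (Matrix.of fun r s : Fin (n + 1) =>
        chainCoeff n τ γ a₁ a₂ β₁ β₂ r.val s.val 0)) := by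
    refine tendsto_pi_nhds.mpr fun r => tendsto_pi_nhds.mpr fun s => ?_
    exact tendsto_tsum_pow_mul (geomBounded_chainCoeff hτ hg r.val s.val)
      fun ν hν => nonneg_of_PhiReg_ne_zero (r := r.val) 0 0 (by simp) ν (left_ne_zero_of_mul hν)
  have hdet := ((continuous_id.matrix_det).tendsto _).comp hlim
  exact hdet.eventually_ne (det_chainCoeff_zero_ne_zero hτ hg)

lemma Generic.exists_representsSystem_unique (hτ : 0 < τ.im)
    (hg : Generic n τ γ (qPow τ a₁) (qPow τ a₂) β₁ β₂) :
    ∃ δ : ℝ, 0 < δ ∧ ∀ α : ℂ, ‖qPow τ α‖ < δ → ∀ K K',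
      RepresentsSystem n τ α γ (qPow τ a₁) (qPow τ a₂) β₁ β₂ K →
      RepresentsSystem n τ α γ (qPow τ a₁) (qPow τ a₂) β₁ β₂ K' → K = K' := by
  have hX : ∀ r : Fin (n + 1), AvoidsPoles τ γ (qPow τ a₁) (qPow τ a₂) β₁ β₂
      (chainPoint (n := n) γ a₁ a₂ r.val) :=
    fun _ => hg.avoidsPoles_chainPoint
  -- The radius must ensure invertibility together with convergence on all `n + 1` lattices, both at
  -- `x₂` (`e = 0`) and at `q x₂` (`e = 1`).
  have hev := (eventually_det_ne_zero hτ hg).and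
    ((Filter.eventually_all.mpr fun r : Fin (n + 1) =>
      eventually_converges_chainPoint hτ r.val 0 (by simp) (hX r)).and
    (Filter.eventually_all.mpr fun r : Fin (n + 1) =>
      eventually_converges_chainPoint hτ r.val 1
        (by rw [Nat.cast_one, qPow_add, mul_comm]) (hX r).shift))
  obtain ⟨δ, hδ, hball⟩ := Metric.eventually_nhds_iff.mp hev
  refine ⟨δ, hδ, fun α hα K K' hK hK' => ?_⟩
  obtain ⟨hdet, hc, hc'⟩ := hball (y := qPow τ α) (by rwa [dist_zero_right])
  set G := Matrix.of fun r s : Fin (n + 1) => ∑' ν : Fin n → ℤ,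
    qPow τ α ^ (∑ j, (ν j).toNat) * chainCoeff n τ γ a₁ a₂ β₁ β₂ r.val s.val ν with hG
  have hmul : G * K = G * K' := by
    ext r s
    have h := (hK _ (hX r) (hc r α rfl) (hc' r α rfl) s).symm.trans
      (hK' _ (hX r) (hc r α rfl) (hc' r α rfl) s)
    simp only [phiTilde_chainPoint, mul_assoc] at h
    have h1 : (1 - qPow τ 1) ^ n ≠ 0 := by
      refine pow_ne_zero _ (sub_ne_zero.mpr fun e => ?_)
      have := norm_qPow_one_lt hτ
      rw [← e, norm_one] at this
      exact lt_irrefl _ this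
    simp only [← Finset.mul_sum] at h
    exact mul_left_cancel₀ (qPow_ne_zero _ _) (mul_left_cancel₀ h1 h)
  have hu : IsUnit G.det := hdet.isUnit
  rw [← Matrix.nonsing_inv_mul_cancel_left G K hu, hmul, Matrix.nonsing_inv_mul_cancel_left G K' hu]

end Uniqueness

end QKZ

end

theorem corollary1p3p9 (n : ℕ) (τ γ x₁ x₂ β₁ β₂ : ℂ) (hτ : 0 < τ.im)
    (hx₁ : x₁ ≠ 0) (hx₂ : x₂ ≠ 0)
    (hγ : ∀ k : ℕ, 1 ≤ k → k ≤ n → QKZ.qPow τ (k * γ) ≠ 1)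
    (hden : ∀ k : ℕ, k < n → x₂ / x₁ * QKZ.qPow τ (-β₂ - k * γ) ≠ 1) :
    (∃! R, QKZ.IsRMatrix n τ γ x₁ x₂ β₁ β₂ R) ∧
    ∀ R, QKZ.IsRMatrix n τ γ x₁ x₂ β₁ β₂ R →
      R.det = ∏ r ∈ Finset.range (n + 1),
        QKZ.qPow τ (-((n - r) * (β₂ + r * γ))) *
          (QKZ.qPoch (x₂ / x₁ * QKZ.qPow τ β₁) (QKZ.qPow τ γ) r /
            QKZ.qPoch (x₂ / x₁ * QKZ.qPow τ (-β₂ - (r - 1) * γ)) (QKZ.qPow τ γ) r) ∧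
      (∀ α : ℂ, ∃ K, QKZ.RepresentsSystem n τ α γ x₁ x₂ β₁ β₂ K ∧
        K.det = QKZ.qPow τ ((α - (n - 1) * γ) * (n * (n + 1) / 2)) * R.det) ∧
      (QKZ.Generic n τ γ x₁ x₂ β₁ β₂ → ∃ δ : ℝ, 0 < δ ∧ ∀ α : ℂ, ‖QKZ.qPow τ α‖ < δ →
        (∃! K, QKZ.RepresentsSystem n τ α γ x₁ x₂ β₁ β₂ K) ∧
        ∀ K, QKZ.RepresentsSystem n τ α γ x₁ x₂ β₁ β₂ K →
          K.det = QKZ.qPow τ ((α - (n - 1) * γ) * (n * (n + 1) / 2)) * R.det) := by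
  refine ⟨QKZ.existsUnique_isRMatrix hx₁ hx₂ hγ hden, fun R hR => ?_⟩
  have hK := fun α => QKZ.exists_representsSystem hτ hx₁ hx₂ α
    (QKZ.matsuoNum_eq_sum_of_mul_eq (QKZ.mul_eq_of_isRMatrix hx₁ hx₂ hγ hR))
  refine ⟨QKZ.det_of_isRMatrix hx₁ hx₂ hγ hden hR, hK, fun hg => ?_⟩
  obtain ⟨a₁, rfl⟩ := QKZ.exists_qPow_eq hτ hx₁
  obtain ⟨a₂, rfl⟩ := QKZ.exists_qPow_eq hτ hx₂
  obtain ⟨δ, hδ, huniq⟩ := hg.exists_representsSystem_unique hτ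
  refine ⟨δ, hδ, fun α hα => ?_⟩
  obtain ⟨K₀, hK₀, hdet⟩ := hK α
  refine ⟨⟨K₀, hK₀, fun K hK => huniq α hα K K₀ hK hK₀⟩, fun K hK => ?_⟩
  rw [huniq α hα K K₀ hK hK₀, hdet]
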